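/- Two independent sets $I,J$ of a finite simple graph $G$ are called adjacent if the subgraph $G[I\bigtriangleup J]$ induced by their symmetric difference is connected. The problem SymISR asks, given a graph $G$, two independent sets $I_s,I_t$ of $G$ and an integer $k\ge 0$, whether there is a sequence $I_s=I_0,I_1,\dots,I_\ell=I_t$ of independent sets of $G$ of length $\ell\le k$ such that $I_{i-1}$ and $I_i$ are adjacent for every $1\le i\le \ell$. **Theorem.** SymISR can be solved in $O(n^2)$ time on trees, where $n$ is the number of vertices. That is, there are a program for the word RAM and constants $c, C$ such that for every tree $G$ on the vertex set $\{0,\dots,n-1\}$, given by a list of its edges (in arbitrary order and orientation), all independent sets $I_s,I_t$ of $G$, given by their characteristic vectors, every integer $k\ge 0$, and every word length $w\ge c\,(\lfloor\log_2 n\rfloor+1)$ with $k<2^w$, the program run with $w$-bit words halts after at most $C n^2$ steps and answers correctly whether $(G,I_s,I_t,k)$ is a yes-instance of SymISR. -/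

import Mathlib

/-! ## Symmetric-difference reconfiguration of independent sets -/

/-- Two vertex sets `I` and `J` are adjacent when `I ∆ J` induces a connected subgraph of `G`. -/
def SimpleGraph.FlipAdj {V : Type*} (G : SimpleGraph V) (I J : Set V) : Prop :=
  (G.induce (symmDiff I J)).Connected

/-- There is a sequence `Is = I 0, I 1, …, I ℓ = It` of independent sets of `G` of length `ℓ ≤ k`
in which consecutive sets are adjacent. -/
def SimpleGraph.SymISR {V : Type*} (G : SimpleGraph V) (Is It : Set V) (k : ℕ) : Prop :=
  ∃ ℓ : ℕ, ℓ ≤ k ∧ ∃ I : ℕ → Set V, I 0 = Is ∧ I ℓ = It ∧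
    (∀ i, i ≤ ℓ → G.IsIndepSet (I i)) ∧ ∀ i, i < ℓ → G.FlipAdj (I i) (I (i + 1))

/-- `es` lists every edge of `G` exactly once, in arbitrary order and orientation. -/
def SimpleGraph.IsEdgeList {V : Type*} (G : SimpleGraph V) (es : List (V × V)) : Prop :=
  (∀ u v, G.Adj u v ↔ (u, v) ∈ es ∨ (v, u) ∈ es) ∧ (es.map fun e => s(e.1, e.2)).Nodup

/-! ## The word RAM -/

namespace WordRAM

/-- The state of the machine: registers, and a random-access memory. -/
structure State where
  reg : ℕ → ℕ
  mem : ℕ → ℕ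

/-- The binary operations of the machine. -/
inductive Op where
  | add
  | sub
  | mul
  | lt
  | eq

/-- The result of an operation on words of `w` bits: addition and multiplication modulo `2 ^ w`,
truncated subtraction, and comparisons with result `0` or `1`. -/
def Op.eval (w : ℕ) : Op → ℕ → ℕ → ℕ
  | .add, x, y => (x + y) % 2 ^ w
  | .sub, x, y => x - y
  | .mul, x, y => (x * y) % 2 ^ w
  | .lt, x, y => if x < y then 1 else 0
  | .eq, x, y => if x = y then 1 else 0

/-- Programs: `const d v` sets register `d` to the constant `v`; `op o d a b` sets register `d` to
the result of `o` on registers `a` and `b`; `load d a` reads into register `d` the memory cell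
whose address is in register `a`; `store a b` writes register `b` into the memory cell whose
address is in register `a`; tests ask whether register `a` is nonzero. -/
inductive Prog where
  | skip
  | const (d v : ℕ)
  | op (o : Op) (d a b : ℕ)
  | load (d a : ℕ)
  | store (a b : ℕ)
  | seq (p q : Prog)
  | ite (a : ℕ) (p q : Prog)
  | while (a : ℕ) (p : Prog)

/-- `Run w p s t s'`: on a machine with `w`-bit words, program `p` started in state `s` halts in
state `s'` after exactly `t` steps. Every instruction and every evaluation of a test is one step. -/
inductive Run (w : ℕ) : Prog → State → ℕ → State → Prop where
  | skip (s : State) : Run w .skip s 1 s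
  | const (d v : ℕ) (s : State) :
      Run w (.const d v) s 1 { s with reg := Function.update s.reg d (v % 2 ^ w) }
  | op (o : Op) (d a b : ℕ) (s : State) :
      Run w (.op o d a b) s 1
        { s with reg := Function.update s.reg d (o.eval w (s.reg a) (s.reg b)) }
  | load (d a : ℕ) (s : State) :
      Run w (.load d a) s 1 { s with reg := Function.update s.reg d (s.mem (s.reg a)) }
  | store (a b : ℕ) (s : State) :
      Run w (.store a b) s 1 { s with mem := Function.update s.mem (s.reg a) (s.reg b) }
  | seq {p q : Prog} {s s' s'' : State} {t t' : ℕ} (hp : Run w p s t s')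
      (hq : Run w q s' t' s'') : Run w (.seq p q) s (t + t') s''
  | ite_true {a : ℕ} {p q : Prog} {s s' : State} {t : ℕ} (ha : s.reg a ≠ 0)
      (hp : Run w p s t s') : Run w (.ite a p q) s (1 + t) s'
  | ite_false {a : ℕ} {p q : Prog} {s s' : State} {t : ℕ} (ha : s.reg a = 0)
      (hq : Run w q s t s') : Run w (.ite a p q) s (1 + t) s'
  | while_true {a : ℕ} {p : Prog} {s s' s'' : State} {t t' : ℕ} (ha : s.reg a ≠ 0)
      (hp : Run w p s t s') (hq : Run w (.while a p) s' t' s'') :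
      Run w (.while a p) s (1 + t + t') s''
  | while_false {a : ℕ} {p : Prog} {s : State} (ha : s.reg a = 0) :
      Run w (.while a p) s 1 s

/-- The initial state for an instance of SymISR. Register `0` holds the number `n` of vertices,
register `1` holds `k`. The memory holds, one word per item, the characteristic vector of `Is`
(`n` words), that of `It` (`n` words), and then the two endpoints of each edge in turn.
All other registers and cells are `0`. -/
def input {n : ℕ} (Is It : Finset (Fin n)) (k : ℕ) (es : List (Fin n × Fin n)) : State where
  reg := fun i => if i = 0 then n else if i = 1 then k else 0
  mem := fun i =>
    ((List.finRange n).map (fun v => if v ∈ Is then (1 : ℕ) else 0) ++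
      (List.finRange n).map (fun v => if v ∈ It then 1 else 0) ++
      es.flatMap (fun e : Fin n × Fin n => [(e.1 : ℕ), (e.2 : ℕ)])).getD i 0

end WordRAM

/-!
Let `X` be the symmetric difference of `Is` and `It`, and give an edge `uv` of the tree the length
`len u v ∈ {0, 1, 2}`: the number of sets among `Is` and `It` that contain neither `u` nor `v`. The
proof determines the distance between `Is` and `It` through the number `ρ v` of flips that contain
the vertex `v`.

*Lower bound.* Every flip is a connected set of vertices of a tree, so it spans one edge less than
it has vertices. Hence a sequence has length `∑ ρ v` minus the number of flips shared by the ends of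
an edge, summed over all edges. The ends of an edge share at most `min (ρ u) (ρ v)` flips, and one
less if `len u v = 2` and `ρ u = ρ v > 0`: if both ends start outside the independent set, the first
flip that touches the edge contains only one of them (`card_flips_inter_le`). Raising `ρ u` by two
where it is more than `len u v` below `ρ v` does not increase the resulting expression, so `ρ` may
be assumed to satisfy `|ρ u - ρ v| ≤ len u v` on all edges (`exists_lipschitz`). Such a `ρ` is a
*profile*; its *cost* is the expression above, rewritten as a sum over a rooted tree.

*Upper bound.* A profile can be realized at its cost (`symISR_of_profile`). Every vertex receives
a time window of `ρ v` consecutive integers such that the windows of adjacent vertices start, and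
end, at the same time or one apart, as dictated by `Is` and `It`. At each time the components of the
set of vertices whose window contains it are flipped one by one. The states in between are
independent, and the overlaps of the windows are the numbers of shared flips.

*Algorithm.* By these bounds, the distance is the least cost of a profile, and values up to `n`
suffice. As `ρ v` has a prescribed parity and changes by at most `2` along an edge, removing a leaf
and charging its least cost to its neighbour takes constant time for each value at the neighbour
(`feasible_absorb_iff`); altogether this takes time `O(n²)`. The order in which the leaves are
removed comes from growing a spanning tree: each of `n` rounds scans the edge list and attaches
every unvisited vertex that is seen next to a visited one (`ends_grow`). The program is `solve`;
statements about programs have the form `Ends w p T s Q`, and are proved instruction by instruction.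
-/

namespace SymISRTree

open Finset

/-! ### Trees grown from a root, and profiles -/

/-- `Grows r M A`: the vertex set `A` is obtained from `{r}` by successively attaching a new
vertex `c` to an old vertex `p`; the list `M` holds the pairs `(p, c)`, the last one first. -/
inductive Grows {V : Type*} [DecidableEq V] (r : V) : List (V × V) → Finset V → Prop
  | nil : Grows r [] {r}
  | cons {M : List (V × V)} {A : Finset V} {p c : V} :
      Grows r M A → p ∈ A → c ∉ A → Grows r ((p, c) :: M) (insert c A)

/-- `gap S u v` is `1` if neither `u` nor `v` belongs to `S`, and `0` otherwise. -/
def gap {V : Type*} [DecidableEq V] (S : Finset V) (u v : V) : ℕ :=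
  if u ∈ S ∨ v ∈ S then 0 else 1

/-- The length of an edge `uv` with respect to the initial set `Is` and the final set `It`. -/
def len {V : Type*} [DecidableEq V] (Is It : Finset V) (u v : V) : ℕ := gap Is u v + gap It u v

/-- The parity of the number of times that `v` is flipped on the way from `Is` to `It`. -/
def par {V : Type*} [DecidableEq V] (Is It : Finset V) (v : V) : ℕ :=
  if v ∈ Is ↔ v ∈ It then 0 else 1

/-- The largest number of flips that the ends of an edge of length `ℓ` can have in common, if they
are flipped `a` and `b` times. -/
def shared (ℓ a b : ℕ) : ℕ := min a b - if ℓ = 2 ∧ a = b then 1 else 0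

/-- The least number of flips that contain the second end of an edge of length `ℓ` but not the
first one, if they are flipped `b` and `a` times. -/
def excess (ℓ a b : ℕ) : ℕ := b - shared ℓ a b

/-- The number of pairs in the list `M` with both entries in `K`. -/
def inner {V : Type*} [DecidableEq V] (M : List (V × V)) (K : Finset V) : ℕ :=
  (M.map fun e => if e.1 ∈ K ∧ e.2 ∈ K then 1 else 0).sum

/-- A profile prescribes how often each vertex is flipped: with the parity forced by `Is` and `It`,
and changing along each edge by at most its length. -/
structure IsProfile {V : Type*} [DecidableEq V] (Is It : Finset V) (M : List (V × V))
    (ρ : V → ℕ) : Prop where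
  parity : ∀ v, ρ v % 2 = par Is It v
  lip : ∀ e ∈ M, ρ e.1 ≤ ρ e.2 + len Is It e.1 e.2 ∧ ρ e.2 ≤ ρ e.1 + len Is It e.1 e.2

/-- The number of flips that a profile costs: those of the root, and for each further vertex those
that its parent does not share. -/
def cost {V : Type*} [DecidableEq V] (Is It : Finset V) (r : V) (M : List (V × V))
    (ρ : V → ℕ) : ℕ :=
  ρ r + (M.map fun e => excess (len Is It e.1 e.2) (ρ e.1) (ρ e.2)).sum

section

variable {V : Type*} [DecidableEq V] {Is It A : Finset V} {M : List (V × V)} {r : V}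

theorem shared_le_right (ℓ a b : ℕ) : shared ℓ a b ≤ b := by unfold shared; omega

theorem shared_comm (ℓ a b : ℕ) : shared ℓ a b = shared ℓ b a := by
  unfold shared; split_ifs <;> omega

theorem shared_le_add_two (ℓ a b : ℕ) : shared ℓ a b ≤ shared ℓ (a + 2) b := by
  unfold shared; split_ifs <;> omega

theorem shared_add_two {ℓ a b : ℕ} (h : a + ℓ + 2 ≤ b) :
    shared ℓ (a + 2) b = shared ℓ a b + 2 := by
  unfold shared; split_ifs <;> omega

theorem gap_comm (S : Finset V) (u v : V) : gap S u v = gap S v u := by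
  unfold gap; simp only [or_comm]

theorem len_comm (Is It : Finset V) (u v : V) : len Is It u v = len Is It v u := by
  unfold len; rw [gap_comm Is, gap_comm It]

theorem par_le_one (v : V) : par Is It v ≤ 1 := by unfold par; split_ifs <;> omega

/-- The values of a profile at the ends of an edge differ by the length of the edge, modulo two. -/
theorem len_add_par {G : SimpleGraph V} (hIs : G.IsIndepSet (Is : Set V))
    (hIt : G.IsIndepSet (It : Set V)) {u v : V} (h : G.Adj u v) :
    (len Is It u v + par Is It u + par Is It v) % 2 = 0 := by
  have h1 : ¬ (u ∈ Is ∧ v ∈ Is) := fun ⟨a, b⟩ => hIs (by simpa using a) (by simpa using b) h.ne h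
  have h2 : ¬ (u ∈ It ∧ v ∈ It) := fun ⟨a, b⟩ => hIt (by simpa using a) (by simpa using b) h.ne h
  unfold len par gap
  by_cases a : u ∈ Is <;> by_cases b : v ∈ Is <;> by_cases c : u ∈ It <;> by_cases d : v ∈ It <;>
    simp_all

theorem Grows.mem_of_mem (h : Grows r M A) : ∀ e ∈ M, e.1 ∈ A ∧ e.2 ∈ A := by
  induction h with
  | nil => simp
  | cons _ hp _ ih =>
    intro e he
    rcases List.mem_cons.1 he with rfl | he
    · simp [hp]
    · simp [ih e he]

theorem Grows.root_mem (h : Grows r M A) : r ∈ A := by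
  induction h with
  | nil => simp
  | cons _ _ _ ih => simp [ih]

theorem Grows.card_eq (h : Grows r M A) : A.card = M.length + 1 := by
  induction h with
  | nil => simp
  | cons _ _ hc ih => simp [card_insert_of_notMem hc, ih]

theorem Grows.sum_eq (h : Grows r M A) (f : V → ℕ) :
    ∑ v ∈ A, f v = f r + (M.map fun e => f e.2).sum := by
  induction h with
  | nil => simp
  | cons _ _ hc ih => rw [sum_insert hc, ih]; simp only [List.map_cons, List.sum_cons]; omega

/-- A set of vertices of a tree spans fewer edges than it has vertices. -/
theorem Grows.inner_add_le (h : Grows r M A) (K : Finset V) :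
    inner M K + (if (K ∩ A).Nonempty then 1 else 0) ≤ (K ∩ A).card := by
  induction h with
  | nil =>
    simp only [inner, List.map_nil, List.sum_nil]
    split_ifs with h
    · simpa using h.card_pos
    · omega
  | @cons M A p c _ hp hc ih =>
    by_cases hcK : c ∈ K
    · have hcard : (K ∩ insert c A).card = (K ∩ A).card + 1 := by
        rw [inter_insert_of_mem hcK, card_insert_of_notMem (by simp [hc])]
      rw [hcard]
      simp only [inner, List.map_cons, List.sum_cons] at ih ⊢
      by_cases hpK : p ∈ K
      · have h1 : (K ∩ A).Nonempty := ⟨p, by simp [hp, hpK]⟩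
        rw [if_pos h1] at ih
        rw [if_pos ⟨hpK, hcK⟩]
        split_ifs <;> omega
      · rw [if_neg (by tauto)]
        split_ifs at * <;> omega
    · rw [inter_insert_of_notMem hcK]
      simpa [inner, hcK] using ih

theorem sum_map_sum_comm {α : Type*} (M : List α) (s : Finset ℕ) (f : ℕ → α → ℕ) :
    (M.map fun e => ∑ i ∈ s, f i e).sum = ∑ i ∈ s, (M.map (f i)).sum := by
  induction M with
  | nil => simp
  | cons e M ih => simp [ih, sum_add_distrib]

theorem sum_map_mono {α : Type*} {M : List α} {f g : α → ℕ} (h : ∀ e ∈ M, f e ≤ g e) :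
    (M.map f).sum ≤ (M.map g).sum := List.sum_le_sum h

theorem sum_map_add_le {α : Type*} {M : List α} {f g : α → ℕ} (d : ℕ) (h : ∀ e ∈ M, f e ≤ g e)
    (hd : ∃ e ∈ M, f e + d ≤ g e) : (M.map f).sum + d ≤ (M.map g).sum := by
  induction M with
  | nil => simp at hd
  | cons a M ih =>
    simp only [List.map_cons, List.sum_cons]
    have ha := h a (by simp)
    have hM : ∀ e ∈ M, f e ≤ g e := fun e he => h e (by simp [he])
    obtain ⟨e, he, hed⟩ := hd
    rcases List.mem_cons.1 he with rfl | he
    · have := sum_map_mono hM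
      omega
    · have := ih hM ⟨e, he, hed⟩
      omega

end

/-! ### Every reconfiguration sequence yields a profile -/

open Classical in
/-- The times before `ℓ` at which `v` is flipped. -/
noncomputable def flips {V : Type*} (I : ℕ → Set V) (ℓ : ℕ) (v : V) : Finset ℕ :=
  (range ℓ).filter fun i => v ∈ symmDiff (I i) (I (i + 1))

theorem mem_iff_even_card_flips {V : Type*} (I : ℕ → Set V) (v : V) (j : ℕ) :
    v ∈ I j ↔ (v ∈ I 0 ↔ Even (flips I j v).card) := by
  classical
  induction j with
  | zero => simp [flips]
  | succ j ih =>
    have h : (flips I (j + 1) v).card =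
        (flips I j v).card + if v ∈ symmDiff (I j) (I (j + 1)) then 1 else 0 := by
      unfold flips
      rw [range_add_one, filter_insert]
      split_ifs with h
      · rw [card_insert_of_notMem (by simp)]
      · simp
    rw [h]
    by_cases a : v ∈ I j <;> by_cases b : v ∈ I (j + 1) <;>
      simp [Set.mem_symmDiff, a, b, Nat.even_add_one, -Nat.not_even_iff_odd] at ih ⊢ <;> tauto

section

variable {V : Type*} [DecidableEq V] {G : SimpleGraph V} {Is It A : Finset V}
  {M : List (V × V)} {r : V}

/-- A connected set of vertices spans at least as many edges as it has vertices, minus one. -/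
theorem card_le_inner_add_one (hadj : ∀ u v, G.Adj u v ↔ (u, v) ∈ M ∨ (v, u) ∈ M) (K : Finset V)
    (hK : (G.induce (K : Set V)).Connected) : K.card ≤ inner M K + 1 := by
  classical
  have h1 := hK.card_vert_le_card_edgeSet_add_one
  rw [Nat.card_eq_fintype_card, Nat.card_eq_fintype_card] at h1
  have h2 : Fintype.card ((K : Set V) : Type _) = K.card := by simp
  rw [h2] at h1
  refine h1.trans (Nat.add_le_add_right ?_ 1)
  rw [← SimpleGraph.edgeFinset_card]
  rw [← card_image_of_injective _ (Sym2.map.injective Subtype.val_injective)]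
  have h3 : ((G.induce (K : Set V)).edgeFinset.image (Sym2.map Subtype.val)) ⊆
      ((M.filter fun e => e.1 ∈ K ∧ e.2 ∈ K).map fun e => s(e.1, e.2)).toFinset := by
    intro e he
    obtain ⟨e', he', rfl⟩ := mem_image.1 he
    induction e' with
    | _ a b =>
      rw [SimpleGraph.mem_edgeFinset, SimpleGraph.mem_edgeSet] at he'
      have ha : (a : V) ∈ K := a.2
      have hb : (b : V) ∈ K := b.2
      have hab : G.Adj a b := he'
      rw [List.mem_toFinset, List.mem_map]
      rcases (hadj _ _).1 hab with h | h
      · exact ⟨(a, b), by simp [h, ha, hb], rfl⟩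
      · exact ⟨(b, a), by simp [h, ha, hb], by simp [Sym2.eq_swap]⟩
  refine (card_le_card h3).trans ((List.toFinset_card_le _).trans ?_)
  rw [List.length_map]
  clear h3 h1 h2 hadj
  unfold inner
  induction M with
  | nil => simp
  | cons e M ih =>
    by_cases he : e.1 ∈ K ∧ e.2 ∈ K
    · rw [List.filter_cons_of_pos (by simpa using he)]
      simp only [List.length_cons, List.map_cons, List.sum_cons, if_pos he]
      omega
    · rw [List.filter_cons_of_neg (by simpa using he)]
      simp only [List.map_cons, List.sum_cons, if_neg he]
      omega

/-- The ends of an edge have no more flips in common than `shared` allows: if both ends lie outside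
`Is`, then the first flip that touches the edge contains only one of them. -/
theorem card_flips_inter_le {I : ℕ → Set V} {ℓ : ℕ} (h0 : I 0 = Is)
    (hI : ∀ i, i ≤ ℓ → G.IsIndepSet (I i)) {u v : V} (huv : G.Adj u v) :
    (flips I ℓ u ∩ flips I ℓ v).card ≤
      shared (len Is It u v) (flips I ℓ u).card (flips I ℓ v).card := by
  classical
  have h1 := card_le_card (inter_subset_left (s₁ := flips I ℓ u) (s₂ := flips I ℓ v))
  have h2 := card_le_card (inter_subset_right (s₁ := flips I ℓ u) (s₂ := flips I ℓ v))
  unfold shared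
  split_ifs with h
  swap
  · omega
  obtain ⟨hl, hc⟩ := h
  by_contra hcon
  have hne : (flips I ℓ u).card ≠ 0 := by omega
  have e1 := eq_of_subset_of_card_le (inter_subset_left (s₁ := flips I ℓ u) (s₂ := flips I ℓ v))
    (by omega)
  have e2 := eq_of_subset_of_card_le (inter_subset_right (s₁ := flips I ℓ u) (s₂ := flips I ℓ v))
    (by omega)
  have e3 : flips I ℓ u = flips I ℓ v := e1.symm.trans e2
  have hn : (flips I ℓ u).Nonempty := card_ne_zero.1 hne
  have hu : u ∉ Is ∧ v ∉ Is := by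
    unfold len gap at hl
    by_contra hcon
    rw [if_pos (by tauto)] at hl
    split_ifs at hl <;> omega
  -- `i` is the first time at which the edge is touched
  obtain ⟨i, hi, hmin⟩ := (flips I ℓ u).exists_min_image id hn
  have hz : ∀ w, flips I ℓ w = flips I ℓ u → w ∉ Is → w ∈ I (i + 1) := by
    intro w hw hwI
    have hwi : i ∈ flips I ℓ w := hw ▸ hi
    have hne : flips I i w = ∅ := by
      rw [eq_empty_iff_forall_notMem]
      intro j hj
      have hj' : j < i ∧ w ∈ symmDiff (I j) (I (j + 1)) := by simpa [flips] using hj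
      have hil : i < ℓ := by simpa using (mem_filter.1 hi).1
      have : j ∈ flips I ℓ w := by
        unfold flips
        rw [mem_filter]
        exact ⟨mem_range.2 (by omega), hj'.2⟩
      have := hmin j (hw ▸ this)
      simp only [id] at this
      omega
    have hnot : w ∉ I i := by
      rw [mem_iff_even_card_flips I w i, hne, h0]
      simpa using hwI
    have := (mem_filter.1 hwi).2
    rw [Set.mem_symmDiff] at this
    tauto
  have hil : i < ℓ := by simpa using (mem_filter.1 hi).1
  exact hI (i + 1) hil (hz u rfl hu.1) (hz v e3.symm hu.2) huv.ne huv

variable [Fintype V]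

/-- Counting the flips of a sequence through the vertices and edges of the tree. -/
theorem exists_flipCount (hadj : ∀ u v, G.Adj u v ↔ (u, v) ∈ M ∨ (v, u) ∈ M)
    {I : ℕ → Set V} {ℓ : ℕ} (h0 : I 0 = Is) (h1 : I ℓ = It)
    (hI : ∀ i, i ≤ ℓ → G.IsIndepSet (I i)) (hF : ∀ i, i < ℓ → G.FlipAdj (I i) (I (i + 1))) :
    ∃ ρ : V → ℕ, (∀ v, ρ v ≤ ℓ) ∧ (∀ v, ρ v % 2 = par Is It v) ∧
      ∑ v, ρ v ≤ ℓ + (M.map fun e => shared (len Is It e.1 e.2) (ρ e.1) (ρ e.2)).sum := by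
  classical
  refine ⟨fun v => (flips I ℓ v).card, fun v => ?_, fun v => ?_, ?_⟩
  · exact (card_filter_le _ _).trans (by simp)
  · have h := mem_iff_even_card_flips I v ℓ
    rw [h0, h1] at h
    unfold par
    rcases Nat.even_or_odd (flips I ℓ v).card with he | he
    · rw [Nat.even_iff.1 he, if_pos]
      simp only [he, iff_true] at h
      simpa using h.symm
    · rw [Nat.odd_iff.1 he, if_neg]
      have : ¬ Even (flips I ℓ v).card := Nat.not_even_iff_odd.2 he
      simp only [this, iff_false] at h
      intro h'
      simp only [mem_coe] at h
      tauto
  · let H : ℕ → Finset V := fun i => univ.filter fun v => v ∈ symmDiff (I i) (I (i + 1))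
    have hH : ∀ i, (H i : Set V) = symmDiff (I i) (I (i + 1)) := by
      intro i; ext v; simp [H]
    have hsum : ∑ v, (flips I ℓ v).card = ∑ i ∈ range ℓ, (H i).card := by
      simp only [flips, card_filter, H]
      rw [sum_comm]
    have hconn : ∀ i ∈ range ℓ, (H i).card ≤ inner M (H i) + 1 := by
      intro i hi
      refine card_le_inner_add_one hadj _ ?_
      rw [hH]
      exact hF i (mem_range.1 hi)
    have hedge : ∑ i ∈ range ℓ, inner M (H i) ≤
        (M.map fun e =>
          shared (len Is It e.1 e.2) (flips I ℓ e.1).card (flips I ℓ e.2).card).sum := by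
      unfold inner
      rw [← sum_map_sum_comm M (range ℓ) fun i e => if e.1 ∈ H i ∧ e.2 ∈ H i then 1 else 0]
      refine sum_map_mono fun e he => ?_
      have hE : G.Adj e.1 e.2 := (hadj _ _).2 (Or.inl he)
      refine le_trans (le_of_eq ?_) (card_flips_inter_le h0 hI hE)
      rw [← card_filter]
      congr 1
      ext i
      simp [flips, H]
      tauto
    calc ∑ v, (flips I ℓ v).card = ∑ i ∈ range ℓ, (H i).card := hsum
      _ ≤ ∑ i ∈ range ℓ, (inner M (H i) + 1) := sum_le_sum hconn
      _ = ℓ + ∑ i ∈ range ℓ, inner M (H i) := by simp [sum_add_distrib, add_comm]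
      _ ≤ _ := by simpa using hedge

/-- Raising a vertex that is flipped too rarely in comparison with a neighbour does not increase the
number of flips; hence flip counts can be assumed to change little along edges. The number `m`
bounds how much the sum of the counts can still grow. -/
theorem exists_lipschitz (hadj : ∀ u v, G.Adj u v ↔ (u, v) ∈ M ∨ (v, u) ∈ M)
    (hIs : G.IsIndepSet (Is : Set V)) (hIt : G.IsIndepSet (It : Set V)) (N K : ℕ) :
    ∀ (m : ℕ) (ρ : V → ℕ), N * Fintype.card V ≤ m + ∑ v, ρ v → (∀ v, ρ v ≤ N) →
      (∀ v, ρ v % 2 = par Is It v) →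
      ∑ v, ρ v ≤ K + (M.map fun e => shared (len Is It e.1 e.2) (ρ e.1) (ρ e.2)).sum →
      ∃ ρ' : V → ℕ, (∀ v, ρ' v ≤ N) ∧ IsProfile Is It M ρ' ∧
        ∑ v, ρ' v ≤ K + (M.map fun e => shared (len Is It e.1 e.2) (ρ' e.1) (ρ' e.2)).sum := by
  intro m
  induction m using Nat.strong_induction_on with
  | _ m ih =>
    intro ρ hm hN hpar hsum
    by_cases hl : ∀ x y, G.Adj x y → ρ y ≤ ρ x + len Is It x y
    · refine ⟨ρ, hN, ⟨hpar, fun e he => ?_⟩, hsum⟩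
      have hE : G.Adj e.1 e.2 := (hadj _ _).2 (Or.inl he)
      refine ⟨?_, hl _ _ hE⟩
      rw [len_comm]
      exact hl _ _ hE.symm
    · push Not at hl
      obtain ⟨x, y, hxy, hlt⟩ := hl
      have hp := len_add_par hIs hIt hxy
      rw [← hpar x, ← hpar y] at hp
      -- the inequality is strict by at least two, for parity reasons
      have hge : ρ x + len Is It x y + 2 ≤ ρ y := by omega
      set ρ' : V → ℕ := Function.update ρ x (ρ x + 2) with hρ'
      have hx : ρ' x = ρ x + 2 := by simp [ρ']
      have hne : ∀ v, v ≠ x → ρ' v = ρ v := fun v hv => by simp [ρ', hv]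
      have hs : ∑ v, ρ' v = ∑ v, ρ v + 2 := by
        rw [hρ', sum_update_of_mem (mem_univ x), ← add_sum_erase _ _ (mem_univ x),
          sdiff_singleton_eq_erase]
        omega
      have hN' : ∀ v, ρ' v ≤ N := by
        intro v
        by_cases hv : v = x
        · have := hN y; subst hv; omega
        · rw [hne v hv]; exact hN v
      have hle : ∑ v, ρ' v ≤ N * Fintype.card V := by
        refine (sum_le_card_nsmul _ _ N fun v _ => hN' v).trans ?_
        simp [mul_comm]
      refine ih (m - 2) (by omega) ρ' (by omega) hN' ?_ ?_
      · intro v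
        by_cases hv : v = x
        · subst hv; rw [hx, ← hpar v]; omega
        · rw [hne v hv]; exact hpar v
      · have key := sum_map_add_le (M := M) 2
          (f := fun e => shared (len Is It e.1 e.2) (ρ e.1) (ρ e.2))
          (g := fun e => shared (len Is It e.1 e.2) (ρ' e.1) (ρ' e.2)) ?_ ?_
        · rw [hs]
          omega
        · intro e he
          have hE : G.Adj e.1 e.2 := (hadj _ _).2 (Or.inl he)
          by_cases h1 : e.1 = x
          · have h2 : e.2 ≠ x := fun h => hE.ne (h1.trans h.symm)
            rw [hne _ h2, h1, hx]
            exact shared_le_add_two _ _ _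
          · rw [hne _ h1]
            by_cases h2 : e.2 = x
            · rw [h2, hx, shared_comm _ (ρ e.1), shared_comm _ (ρ e.1)]
              exact shared_le_add_two _ _ _
            · rw [hne _ h2]
        · have hyx : ρ' y = ρ y := hne y hxy.ne'
          rcases (hadj _ _).1 hxy with h | h
          · refine ⟨_, h, ?_⟩
            simp only [hx, hyx]
            rw [shared_add_two hge]
          · refine ⟨_, h, ?_⟩
            simp only [hx, hyx]
            rw [shared_comm _ _ (ρ x), shared_comm _ _ (ρ x + 2), len_comm, shared_add_two hge]

/-- The cost of a profile is the total number of flips of the vertices, minus the number of those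
shared along the edges. -/
theorem Grows.sum_eq_cost_add (hM : Grows r M univ) (Is It : Finset V) (ρ : V → ℕ) :
    ∑ v, ρ v = cost Is It r M ρ +
      (M.map fun e => shared (len Is It e.1 e.2) (ρ e.1) (ρ e.2)).sum := by
  rw [hM.sum_eq, cost, Nat.add_assoc, ← List.sum_map_add]
  congr 2
  refine List.map_congr_left fun e _ => ?_
  have := shared_le_right (len Is It e.1 e.2) (ρ e.1) (ρ e.2)
  unfold excess
  omega

/-- If `It` can be reached within `k` flips, then some profile with values at most `|V|` costs at
most `k`. -/
theorem exists_profile_of_symISR (hM : Grows r M univ)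
    (hadj : ∀ u v, G.Adj u v ↔ (u, v) ∈ M ∨ (v, u) ∈ M)
    (hIs : G.IsIndepSet (Is : Set V)) (hIt : G.IsIndepSet (It : Set V)) {k : ℕ}
    (h : G.SymISR (Is : Set V) (It : Set V) k) :
    ∃ ρ : V → ℕ, (∀ v, ρ v ≤ Fintype.card V) ∧ IsProfile Is It M ρ ∧ cost Is It r M ρ ≤ k := by
  obtain ⟨ℓ, hℓ, I, h0, h1, hI, hF⟩ := h
  obtain ⟨ρ, N, K, hN, hρ, hpar, hs, hK⟩ : ∃ (ρ : V → ℕ) (N K : ℕ), N ≤ Fintype.card V ∧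
      (∀ v, ρ v ≤ N) ∧ (∀ v, ρ v % 2 = par Is It v) ∧
      ∑ v, ρ v ≤ K + (M.map fun e => shared (len Is It e.1 e.2) (ρ e.1) (ρ e.2)).sum ∧ K ≤ k := by
    by_cases hc : ℓ ≤ Fintype.card V
    · obtain ⟨ρ, a, b, c⟩ := exists_flipCount hadj h0 h1 hI hF
      exact ⟨ρ, ℓ, ℓ, hc, a, b, c, hℓ⟩
    · -- a long sequence: flipping each vertex of the symmetric difference once is cheap enough
      have hcard : 1 ≤ Fintype.card V := Fintype.card_pos_iff.2 ⟨r⟩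
      refine ⟨par Is It, 1, Fintype.card V, hcard, par_le_one, fun v => ?_, ?_, by omega⟩
      · have := par_le_one (Is := Is) (It := It) v
        omega
      · refine le_trans (sum_le_card_nsmul _ _ 1 fun v _ => par_le_one v) ?_
        simp
  obtain ⟨ρ', hN', hp, hs'⟩ := exists_lipschitz hadj hIs hIt N K _ ρ le_self_add hρ hpar hs
  rw [hM.sum_eq_cost_add Is It ρ'] at hs'
  exact ⟨ρ', fun v => (hN' v).trans hN, hp, by omega⟩

end

/-! ### Every profile is realized by a reconfiguration sequence -/

section

variable {V : Type*} {G : SimpleGraph V} {I J K : Set V} {a b : ℕ}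

theorem symISR_refl (h : G.IsIndepSet I) : G.SymISR I I 0 :=
  ⟨0, le_rfl, fun _ => I, rfl, rfl, fun _ _ => h, fun i hi => absurd hi (Nat.not_lt_zero i)⟩

theorem symISR_mono (h : G.SymISR I J a) (hab : a ≤ b) : G.SymISR I J b := by
  obtain ⟨ℓ, hℓ, r⟩ := h
  exact ⟨ℓ, hℓ.trans hab, r⟩

theorem symISR_single (hI : G.IsIndepSet I) (hJ : G.IsIndepSet J) (h : G.FlipAdj I J) :
    G.SymISR I J 1 := by
  refine ⟨1, le_rfl, fun i => if i = 0 then I else J, by simp, by simp, fun i _ => ?_,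
    fun i hi => ?_⟩
  · dsimp only; split_ifs <;> assumption
  · obtain rfl : i = 0 := by omega
    simpa using h

theorem symISR_trans (h1 : G.SymISR I J a) (h2 : G.SymISR J K b) : G.SymISR I K (a + b) := by
  obtain ⟨ℓ, hℓ, X, x0, x1, xI, xF⟩ := h1
  obtain ⟨m, hm, Y, y0, y1, yI, yF⟩ := h2
  refine ⟨ℓ + m, by omega, fun i => if i ≤ ℓ then X i else Y (i - ℓ), by simpa using x0, ?_,
    fun i hi => ?_, fun i hi => ?_⟩
  · dsimp only
    split_ifs with h
    · obtain rfl : m = 0 := by omega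
      rw [Nat.add_zero, x1, ← y0, y1]
    · rw [Nat.add_sub_cancel_left, y1]
  · dsimp only
    split_ifs with h
    · exact xI i h
    · exact yI _ (by omega)
  · dsimp only
    rcases lt_trichotomy i ℓ with h | h | h
    · rw [if_pos h.le, if_pos (by omega : i + 1 ≤ ℓ)]
      exact xF i h
    · subst h
      rw [if_pos le_rfl, if_neg (by omega), x1, ← y0, Nat.add_sub_cancel_left]
      exact yF 0 (by omega)
    · rw [if_neg (by omega), if_neg (by omega), show i + 1 - ℓ = i - ℓ + 1 by omega]
      exact yF _ (by omega)

theorem induce_singleton_connected (G : SimpleGraph V) (x : V) :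
    (G.induce ({x} : Set V)).Connected where
  preconnected := fun a b => by rw [Subsingleton.elim a b]
  nonempty := ⟨⟨x, rfl⟩⟩

end

section

variable {V : Type*} [DecidableEq V] {G : SimpleGraph V} {Is It : Finset V}
  {M : List (V × V)} {r : V}

theorem inner_le_card [Fintype V] (hM : Grows r M univ) (D : Finset V) : inner M D ≤ D.card := by
  have := hM.inner_add_le D
  rw [inter_univ] at this
  omega

/-- A nonempty finite set contains a connected subset that is not joined to the rest. -/
theorem exists_component (G : SimpleGraph V) {D : Finset V} (hD : D.Nonempty) :
    ∃ K ⊆ D, K.Nonempty ∧ (G.induce (K : Set V)).Connected ∧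
      ∀ u ∈ K, ∀ v ∈ D, v ∉ K → ¬ G.Adj u v := by
  classical
  obtain ⟨x, hx⟩ := hD
  have hne : (D.powerset.filter fun K : Finset V => (G.induce (K : Set V)).Connected).Nonempty := by
    refine ⟨{x}, ?_⟩
    rw [mem_filter, mem_powerset, singleton_subset_iff, coe_singleton]
    exact ⟨hx, induce_singleton_connected G x⟩
  obtain ⟨K, hK, hmax⟩ := exists_max_image _ card hne
  rw [mem_filter, mem_powerset] at hK
  refine ⟨K, hK.1, ?_, hK.2, fun u hu v hv hvK huv => ?_⟩
  · obtain ⟨y⟩ := hK.2.nonempty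
    exact ⟨y, y.2⟩
  · have h : (G.induce ((insert v K : Finset V) : Set V)).Connected := by
      have h1 : ((insert v K : Finset V) : Set V) = (K : Set V) ∪ {v} := by
        rw [coe_insert, Set.union_singleton]
      rw [h1]
      exact SimpleGraph.connected_induce_union hK.2.preconnected
        (induce_singleton_connected G v).preconnected (by simpa using hu) rfl huv
    have := hmax (insert v K) (by
      rw [mem_filter, mem_powerset]
      exact ⟨insert_subset hv hK.1, h⟩)
    rw [card_insert_of_notMem hvK] at this
    omega

/-- One can pass between two independent sets by flipping the components of their symmetric
difference one after the other. -/
theorem symISR_of_card_le [Fintype V] (hM : Grows r M univ)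
    (hadj : ∀ u v, G.Adj u v ↔ (u, v) ∈ M ∨ (v, u) ∈ M) {J : Set V} (hJ : G.IsIndepSet J) :
    ∀ (m : ℕ) (I : Set V) (D : Finset V) (k : ℕ), D.card ≤ m → G.IsIndepSet I →
      (D : Set V) = symmDiff I J → D.card ≤ inner M D + k → G.SymISR I J k := by
  intro m
  induction m with
  | zero =>
    intro I D k hm hI hD _
    obtain rfl : D = ∅ := card_eq_zero.1 (by omega)
    rw [coe_empty] at hD
    obtain rfl : I = J := symmDiff_eq_bot.1 hD.symm
    exact symISR_mono (symISR_refl hJ) (Nat.zero_le k)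
  | succ m ih =>
    intro I D k hm hI hD hk
    rcases D.eq_empty_or_nonempty with rfl | hne
    · exact ih I ∅ k (by simp) hI hD (by simp)
    obtain ⟨K, hKD, hKne, hKc, hsep⟩ := exists_component G hne
    have hmemD : ∀ v, v ∈ D ↔ (v ∈ I ∧ v ∉ J ∨ v ∈ J ∧ v ∉ I) := by
      intro v
      rw [← mem_coe, hD, Set.mem_symmDiff]
    have hind : G.IsIndepSet (symmDiff I (K : Set V)) := by
      have hmem : ∀ v, v ∈ symmDiff I (K : Set V) →
          (v ∈ K ∧ v ∈ J) ∨ (v ∉ K ∧ v ∈ I) := by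
        intro v hv
        rw [Set.mem_symmDiff, mem_coe] at hv
        rcases hv with hv | hv
        · exact Or.inr ⟨hv.2, hv.1⟩
        · have := (hmemD v).1 (hKD hv.1)
          tauto
      intro u hu v hv huv hE
      have hcross : ∀ x y, G.Adj x y → x ∈ K ∧ x ∈ J → y ∉ K ∧ y ∈ I → False := by
        intro x y hxy hx hy
        by_cases hyJ : y ∈ J
        · exact hJ hx.2 hyJ hxy.ne hxy
        · exact hsep x hx.1 y ((hmemD y).2 (Or.inl ⟨hy.2, hyJ⟩)) hy.1 hxy
      rcases hmem u hu with h1 | h1 <;> rcases hmem v hv with h2 | h2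
      · exact hJ h1.2 h2.2 huv hE
      · exact hcross u v hE h1 h2
      · exact hcross v u hE.symm h2 h1
      · exact hI h1.2 h2.2 huv hE
    have hflip : G.FlipAdj I (symmDiff I (K : Set V)) := by
      unfold SimpleGraph.FlipAdj
      rw [symmDiff_symmDiff_cancel_left]
      exact hKc
    have hD' : ((D \ K : Finset V) : Set V) = symmDiff (symmDiff I (K : Set V)) J := by
      ext v
      have h1 := hmemD v
      have h2 : v ∈ K → v ∈ D := fun h => hKD h
      rw [mem_coe, mem_sdiff, Set.mem_symmDiff, Set.mem_symmDiff, mem_coe]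
      tauto
    have hinner : inner M D = inner M K + inner M (D \ K) := by
      unfold inner
      rw [← List.sum_map_add]
      congr 1
      refine List.map_congr_left fun e he => ?_
      have hE : G.Adj e.1 e.2 := (hadj _ _).2 (Or.inl he)
      have h1 : e.1 ∈ K → e.2 ∈ D → e.2 ∈ K := fun a b => by
        by_contra c; exact hsep _ a _ b c hE
      have h2 : e.2 ∈ K → e.1 ∈ D → e.1 ∈ K := fun a b => by
        by_contra c; exact hsep _ a _ b c hE.symm
      have h3 : e.1 ∈ K → e.1 ∈ D := fun h => hKD h
      have h4 : e.2 ∈ K → e.2 ∈ D := fun h => hKD h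
      clear hmemD hD hD' hsep hadj
      simp only [mem_sdiff]
      by_cases a : e.1 ∈ K <;> by_cases b : e.2 ∈ K <;> by_cases c : e.1 ∈ D <;>
        by_cases d : e.2 ∈ D <;> simp_all
    have hKi := hM.inner_add_le K
    rw [inter_univ, if_pos hKne] at hKi
    have hDi := hM.inner_add_le D
    rw [inter_univ, if_pos hne] at hDi
    have hc := card_sdiff_add_card_eq_card hKD
    have hKpos := hKne.card_pos
    have := ih (symmDiff I (K : Set V)) (D \ K) (k - 1) (by omega) hind hD' (by omega)
    have := symISR_trans (symISR_single hI hind hflip) this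
    exact symISR_mono this (by omega)

/-- Time windows for a profile `ρ`: the vertex `v` is flipped at the times `α v, …, α v + ρ v - 1`.
The windows of adjacent vertices begin (end) at the same time, unless both vertices lie outside
`Is` (outside `It`), when the difference is one; and they overlap as much as possible. -/
def Windows (Is It : Finset V) (ρ α : V → ℕ) (u v : V) : Prop :=
  (gap Is u v = 0 → α u = α v) ∧ (gap Is u v = 1 → α u = α v + 1 ∨ α v = α u + 1) ∧
  (gap It u v = 0 → α u + ρ u = α v + ρ v) ∧
  (gap It u v = 1 → α u + ρ u = α v + ρ v + 1 ∨ α v + ρ v = α u + ρ u + 1) ∧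
  shared (len Is It u v) (ρ u) (ρ v) ≤ min (α u + ρ u) (α v + ρ v) - max (α u) (α v)

/-- Windows are chosen from the root towards the leaves. If both ends of an edge lie outside `Is`,
the window of the child begins one later than that of its parent, or one earlier if the child is
flipped more often; this makes the overlap as large as possible. The bound `N` leaves
room for windows that begin earlier than that of the root. -/
theorem exists_windows (hIs : G.IsIndepSet (Is : Set V)) (hIt : G.IsIndepSet (It : Set V))
    {A : Finset V} {ρ : V → ℕ} (hA : Grows r M A) (hadj : ∀ e ∈ M, G.Adj e.1 e.2)
    (hρ : IsProfile Is It M ρ) :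
    ∀ N : ℕ, ∃ α : V → ℕ, (∀ v ∈ A, N ≤ α v) ∧ ∀ e ∈ M, Windows Is It ρ α e.1 e.2 := by
  induction hA with
  | nil => exact fun N => ⟨fun _ => N, by simp, by simp⟩
  | @cons M A p c hG hp hc ih =>
    intro N
    obtain ⟨α, hα, hW⟩ := ih (fun e he => hadj e (List.mem_cons_of_mem _ he))
      ⟨hρ.parity, fun e he => hρ.lip e (List.mem_cons_of_mem _ he)⟩ (N + 1)
    have hpc : p ≠ c := fun h => hc (h ▸ hp)
    let x := if gap Is p c = 0 then α p else if ρ c ≤ ρ p then α p + 1 else α p - 1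
    refine ⟨Function.update α c x, fun v hv => ?_, fun e he => ?_⟩
    · have := hα p hp
      rcases mem_insert.1 hv with h | hv
      · rw [h]
        rw [Function.update_self]
        simp only [x]
        split_ifs <;> omega
      · rw [Function.update_of_ne (ne_of_mem_of_not_mem hv hc)]
        have := hα v hv
        omega
    · rcases List.mem_cons.1 he with rfl | he
      · have h1 := hα p hp
        have h2 := len_add_par hIs hIt (hadj (p, c) (by simp))
        have h3 := hρ.lip (p, c) (by simp)
        simp only at h2 h3
        rw [← hρ.parity p, ← hρ.parity c] at h2
        unfold Windows
        simp only [Function.update_self, Function.update_of_ne hpc, x]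
        have g1 : gap Is p c ≤ 1 := by unfold gap; split_ifs <;> omega
        have g2 : gap It p c ≤ 1 := by unfold gap; split_ifs <;> omega
        unfold len at *
        generalize gap Is p c = gs at *
        generalize gap It p c = gt at *
        unfold shared
        generalize α p = a' at *
        generalize ρ p = a at *
        generalize ρ c = b at *
        clear hW hρ ih hα
        refine ⟨?_, ?_, ?_, ?_, ?_⟩ <;> split_ifs <;> omega
      · have h1 := hG.mem_of_mem e he
        have e1 : e.1 ≠ c := fun h => hc (h ▸ h1.1)
        have e2 : e.2 ≠ c := fun h => hc (h ▸ h1.2)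
        have := hW e he
        unfold Windows at *
        rwa [Function.update_of_ne e1, Function.update_of_ne e2]

/-- The set reached at time `τ` when every vertex is flipped once at each time of its window. -/
def stateAt (Is : Finset V) (ρ α : V → ℕ) (τ : ℕ) : Set V :=
  {v | v ∈ Is ↔ Even (min (τ - α v) (ρ v))}

theorem symmDiff_stateAt (Is : Finset V) (ρ α : V → ℕ) (τ : ℕ) :
    symmDiff (stateAt Is ρ α τ) (stateAt Is ρ α (τ + 1)) = {v | α v ≤ τ ∧ τ < α v + ρ v} := by
  ext v
  rw [Set.mem_symmDiff]
  simp only [stateAt, Set.mem_ofPred_eq]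
  by_cases h : α v ≤ τ ∧ τ < α v + ρ v
  · have : min (τ + 1 - α v) (ρ v) = min (τ - α v) (ρ v) + 1 := by omega
    rw [this, Nat.even_add_one]
    simp only [h, and_self, iff_true]
    tauto
  · have : min (τ + 1 - α v) (ρ v) = min (τ - α v) (ρ v) := by omega
    rw [this]
    simp only [h, iff_false]
    tauto

/-- Adjacent vertices are never present together. Inside both windows exactly one of them is there.
A vertex of `Is` that has not been flipped yet is present, but its window begins together with that
of its neighbour, which therefore has not been flipped either; similarly for `It` and the ends. -/
theorem not_both_mem_stateAt {ρ α : V → ℕ} (hpar : ∀ v, ρ v % 2 = par Is It v) {u v : V}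
    (hW : Windows Is It ρ α u v) (hs : ¬ (u ∈ Is ∧ v ∈ Is)) (ht : ¬ (u ∈ It ∧ v ∈ It)) (τ : ℕ) :
    ¬ (u ∈ stateAt Is ρ α τ ∧ v ∈ stateAt Is ρ α τ) := by
  rintro ⟨hu, hv⟩
  obtain ⟨w1, w2, w3, w4, -⟩ := hW
  have pu := hpar u
  have pv := hpar v
  simp only [stateAt, Set.mem_ofPred_eq, Nat.even_iff] at hu hv
  unfold par at pu pv
  unfold gap at w1 w2 w3 w4
  by_cases a : u ∈ Is <;> by_cases b : v ∈ Is <;> by_cases c : u ∈ It <;> by_cases d : v ∈ It <;>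
    simp only [a, b, c, d, true_iff, false_iff, iff_true, iff_false, not_true, not_false_iff,
      and_true, and_false, or_true, or_self, if_true, if_false, forall_const,
      and_self, Nat.zero_ne_one, Nat.one_ne_zero, IsEmpty.forall_iff,
      or_false] at * <;> omega

/-- The profile is realized by a sequence whose length is the number of flips minus the number of
those shared along the edges. -/
theorem symISR_of_profile [Fintype V] (hM : Grows r M univ)
    (hadj : ∀ u v, G.Adj u v ↔ (u, v) ∈ M ∨ (v, u) ∈ M)
    (hIs : G.IsIndepSet (Is : Set V)) (hIt : G.IsIndepSet (It : Set V)) {ρ : V → ℕ}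
    (hρ : IsProfile Is It M ρ) : G.SymISR (Is : Set V) (It : Set V) (cost Is It r M ρ) := by
  have hMadj : ∀ e ∈ M, G.Adj e.1 e.2 := fun e he => (hadj _ _).2 (Or.inl he)
  obtain ⟨α, -, hW⟩ := exists_windows hIs hIt hM hMadj hρ 0
  have hs : ∀ u v, G.Adj u v → ¬ (u ∈ Is ∧ v ∈ Is) := fun u v h ⟨x, y⟩ =>
    hIs (by simpa using x) (by simpa using y) h.ne h
  have ht : ∀ u v, G.Adj u v → ¬ (u ∈ It ∧ v ∈ It) := fun u v h ⟨x, y⟩ =>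
    hIt (by simpa using x) (by simpa using y) h.ne h
  have hind : ∀ τ, G.IsIndepSet (stateAt Is ρ α τ) := by
    intro τ u hu v hv _ huv
    rcases (hadj _ _).1 huv with h | h
    · exact not_both_mem_stateAt hρ.parity (hW _ h) (hs _ _ huv) (ht _ _ huv) τ ⟨hu, hv⟩
    · exact not_both_mem_stateAt hρ.parity (hW _ h) (hs _ _ huv.symm) (ht _ _ huv.symm) τ ⟨hv, hu⟩
  let D : ℕ → Finset V := fun τ => univ.filter fun v => α v ≤ τ ∧ τ < α v + ρ v
  have hD : ∀ τ, (D τ : Set V) = symmDiff (stateAt Is ρ α τ) (stateAt Is ρ α (τ + 1)) := by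
    intro τ
    rw [symmDiff_stateAt]
    ext v
    simp [D]
  have hchain : ∀ T, G.SymISR (stateAt Is ρ α 0) (stateAt Is ρ α T)
      (∑ τ ∈ range T, ((D τ).card - inner M (D τ))) := by
    intro T
    induction T with
    | zero => simpa using symISR_refl (hind 0)
    | succ T ih =>
      rw [sum_range_succ]
      exact symISR_trans ih (symISR_of_card_le hM hadj (hind (T + 1)) _ _ (D T) _ le_rfl (hind T)
        (hD T) (by omega))
  let T := ∑ v, (α v + ρ v)
  have hT : ∀ v, α v + ρ v ≤ T := fun v =>
    single_le_sum (f := fun v => α v + ρ v) (fun _ _ => Nat.zero_le _) (mem_univ v)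
  have hstart : stateAt Is ρ α 0 = Is := by
    ext v
    simp [stateAt]
  have hend : stateAt Is ρ α T = It := by
    ext v
    have h1 := hT v
    have h2 := hρ.parity v
    have h3 : min (T - α v) (ρ v) = ρ v := by omega
    simp only [stateAt, Set.mem_ofPred_eq, h3, mem_coe, Nat.even_iff, h2]
    unfold par
    split_ifs <;> simp <;> tauto
  have h := hchain T
  rw [hstart, hend] at h
  refine symISR_mono h ?_
  have hcount : ∀ a b, b ≤ T → ((range T).filter fun τ => a ≤ τ ∧ τ < b).card = b - a := by
    intro a b hb
    rw [← Nat.card_Ico]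
    congr 1
    ext τ
    simp only [mem_filter, mem_range, mem_Ico]
    omega
  have h1 : ∑ τ ∈ range T, (D τ).card = ∑ v, ρ v := by
    simp only [D, card_filter]
    rw [sum_comm]
    refine sum_congr rfl fun v _ => ?_
    rw [← card_filter, hcount _ _ (hT v)]
    omega
  have h2 : (M.map fun e => shared (len Is It e.1 e.2) (ρ e.1) (ρ e.2)).sum ≤
      ∑ τ ∈ range T, inner M (D τ) := by
    unfold inner
    rw [← sum_map_sum_comm M (range T) fun τ e => if e.1 ∈ D τ ∧ e.2 ∈ D τ then 1 else 0]
    refine sum_map_mono fun e he => ?_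
    refine (hW e he).2.2.2.2.trans (le_of_eq ?_)
    rw [← card_filter, ← hcount _ _ ((min_le_left _ _).trans (hT e.1))]
    congr 1
    ext τ
    simp only [D, mem_filter, mem_univ, true_and, mem_range]
    omega
  have h3 : ∑ τ ∈ range T, ((D τ).card - inner M (D τ)) + ∑ τ ∈ range T, inner M (D τ) =
      ∑ τ ∈ range T, (D τ).card := by
    rw [← sum_add_distrib]
    refine sum_congr rfl fun τ _ => ?_
    have := inner_le_card hM (D τ)
    omega
  have h4 := hM.sum_eq_cost_add Is It ρ
  omega

end

/-! ### Dynamic programming by removing leaves -/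

section

variable {V : Type*} [DecidableEq V]

/-- The number of flips of `v` that is encoded by the table index `i`. -/
def val (Is It : Finset V) (v : V) (i : ℕ) : ℕ := i + i + par Is It v

/-- The values with indices `i` at `u` and `j` at `v` differ by at most the length of `uv`. -/
def Close (Is It : Finset V) (u v : V) (i j : ℕ) : Prop :=
  val Is It u i ≤ val Is It v j + len Is It u v ∧ val Is It v j ≤ val Is It u i + len Is It u v

instance (Is It : Finset V) (u v : V) (i j : ℕ) : Decidable (Close Is It u v i j) :=
  inferInstanceAs (Decidable (_ ∧ _))

/-- The cost of giving the leaf `c` the index `j` if its neighbour `p` has the index `i`, where `F`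
holds the costs of the vertices removed before. -/
def cand (Is It : Finset V) (F : V → ℕ → ℕ) (p c : V) (i j : ℕ) : ℕ :=
  F c j + excess (len Is It p c) (val Is It p i) (val Is It c j)

/-- Replaces `x` by the cost of the index `j` if that is admissible and smaller. -/
def improve (Is It : Finset V) (F : V → ℕ → ℕ) (p c : V) (i j x : ℕ) : ℕ :=
  if Close Is It p c i j ∧ cand Is It F p c i j < x then cand Is It F p c i j else x

/-- The least cost of the leaf `c` if its neighbour `p` has the index `i`; only the indices `i`,
`i - 1` and `i + 1`, as far as they lie between `0` and `N`, are admissible at `c`. -/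
def best (Is It : Finset V) (N : ℕ) (F : V → ℕ → ℕ) (p c : V) (i : ℕ) : ℕ :=
  improve Is It F p c i (i + if i < N then 1 else 0)
    (improve Is It F p c i (i - 1) (cand Is It F p c i i))

/-- The tables after the removal of the leaf `c` with neighbour `p`. -/
def absorb (Is It : Finset V) (N : ℕ) (F : V → ℕ → ℕ) (p c : V) : V → ℕ → ℕ :=
  Function.update F p fun i => F p i + best Is It N F p c i

/-- There are indices, at most `N`, for the vertices of the tree with edges `M` and vertex set `A`
that change admissibly along the edges and whose total cost, including the tables `F`, is at most
`K`. -/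
def Feasible (Is It : Finset V) (r : V) (N : ℕ) (F : V → ℕ → ℕ) (M : List (V × V))
    (A : Finset V) (K : ℕ) : Prop :=
  ∃ x : V → ℕ, (∀ v, x v ≤ N) ∧ (∀ e ∈ M, Close Is It e.1 e.2 (x e.1) (x e.2)) ∧
    val Is It r (x r) + ∑ v ∈ A, F v (x v) +
      (M.map fun e => excess (len Is It e.1 e.2) (val Is It e.1 (x e.1))
        (val Is It e.2 (x e.2))).sum ≤ K

variable {G : SimpleGraph V} {Is It A : Finset V} {M : List (V × V)} {r p c : V} {N K : ℕ}
  {F : V → ℕ → ℕ}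

theorem len_le_two (u v : V) : len Is It u v ≤ 2 := by
  unfold len gap; split_ifs <;> omega

theorem close_self (h : (len Is It p c + par Is It p + par Is It c) % 2 = 0) (i : ℕ) :
    Close Is It p c i i := by
  have h1 := par_le_one (Is := Is) (It := It) p
  have h2 := par_le_one (Is := Is) (It := It) c
  unfold Close val
  omega

/-- Edges have length at most two, so only the three indices that are tried can be admissible. -/
theorem best_le_cand {i j : ℕ} (hi : i ≤ N) (hj : j ≤ N) (h : Close Is It p c i j) :
    best Is It N F p c i ≤ cand Is It F p c i j := by
  have h1 := par_le_one (Is := Is) (It := It) p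
  have h2 := par_le_one (Is := Is) (It := It) c
  have h3 := len_le_two (Is := Is) (It := It) p c
  have h4 : j = i ∨ j = i - 1 ∨ j = i + if i < N then 1 else 0 := by
    unfold Close val at h
    split_ifs <;> omega
  have hle : ∀ j x, improve Is It F p c i j x ≤ x := by
    intro j x; unfold improve; split_ifs <;> omega
  have hle' : ∀ j x, Close Is It p c i j → improve Is It F p c i j x ≤ cand Is It F p c i j := by
    intro j x hj; unfold improve; split_ifs <;> simp_all
  unfold best
  rcases h4 with rfl | rfl | rfl
  · exact (hle _ _).trans (hle _ _)
  · exact (hle _ _).trans (hle' _ _ h)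
  · exact hle' _ _ h

theorem exists_best_eq {i : ℕ} (hi : i ≤ N)
    (hpar : (len Is It p c + par Is It p + par Is It c) % 2 = 0) :
    ∃ j, j ≤ N ∧ Close Is It p c i j ∧ best Is It N F p c i = cand Is It F p c i j := by
  have hstep : ∀ j x, j ≤ N → (∃ j, j ≤ N ∧ Close Is It p c i j ∧ x = cand Is It F p c i j) →
      ∃ j', j' ≤ N ∧ Close Is It p c i j' ∧
        improve Is It F p c i j x = cand Is It F p c i j' := by
    intro j x hj hx
    unfold improve
    split_ifs with h
    · exact ⟨j, hj, h.1, rfl⟩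
    · exact hx
  unfold best
  refine hstep _ _ ?_ (hstep _ _ (by omega) ⟨i, hi, close_self hpar i, rfl⟩)
  split_ifs <;> omega

/-- Giving the leaf the same index as its neighbour costs at most one flip more. -/
theorem best_le (i : ℕ) (hpar : (len Is It p c + par Is It p + par Is It c) % 2 = 0) :
    best Is It N F p c i ≤ F c i + 1 := by
  have hle : ∀ j x, improve Is It F p c i j x ≤ x := by
    intro j x; unfold improve; split_ifs <;> omega
  refine ((hle _ _).trans (hle _ _)).trans ?_
  have h1 := par_le_one (Is := Is) (It := It) p
  have h2 := par_le_one (Is := Is) (It := It) c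
  unfold cand excess shared val
  split_ifs <;> omega

/-- Removing a leaf and absorbing its least cost into its neighbour preserves feasibility. -/
theorem feasible_absorb_iff (hM : Grows r M A) (hp : p ∈ A) (hc : c ∉ A)
    (hpar : (len Is It p c + par Is It p + par Is It c) % 2 = 0) :
    Feasible Is It r N F ((p, c) :: M) (insert c A) K ↔
      Feasible Is It r N (absorb Is It N F p c) M A K := by
  have hsum : ∀ x : V → ℕ, ∑ v ∈ A, absorb Is It N F p c v (x v) =
      ∑ v ∈ A, F v (x v) + best Is It N F p c (x p) := by
    intro x
    rw [← add_sum_erase _ _ hp, ← add_sum_erase _ _ hp]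
    have : ∑ v ∈ A.erase p, absorb Is It N F p c v (x v) = ∑ v ∈ A.erase p, F v (x v) := by
      refine sum_congr rfl fun v hv => ?_
      rw [absorb, Function.update_of_ne (ne_of_mem_erase hv)]
    rw [this, absorb, Function.update_self]
    omega
  constructor
  · rintro ⟨x, hx, hcl, hK⟩
    refine ⟨x, hx, fun e he => hcl e (List.mem_cons_of_mem _ he), ?_⟩
    rw [sum_insert hc] at hK
    simp only [List.map_cons, List.sum_cons] at hK
    have := best_le_cand (p := p) (c := c) (F := F) (hx p) (hx c) (hcl (p, c) (by simp))
    rw [hsum]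
    unfold cand at this
    omega
  · rintro ⟨x, hx, hcl, hK⟩
    obtain ⟨j, hj, hjc, hb⟩ := exists_best_eq (F := F) (hx p) hpar
    have hne : ∀ v ∈ A, Function.update x c j v = x v := fun v hv =>
      Function.update_of_ne (ne_of_mem_of_not_mem hv hc) _ _
    refine ⟨Function.update x c j, fun v => ?_, fun e he => ?_, ?_⟩
    · by_cases hv : v = c
      · rw [hv, Function.update_self]; exact hj
      · rw [Function.update_of_ne hv]; exact hx v
    · rcases List.mem_cons.1 he with rfl | he
      · simp only [Function.update_self, hne p hp]
        exact hjc
      · rw [hne _ (hM.mem_of_mem e he).1, hne _ (hM.mem_of_mem e he).2]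
        exact hcl e he
    · rw [sum_insert hc, sum_congr rfl fun v hv => by rw [hne v hv], hne r hM.root_mem]
      simp only [List.map_cons, List.sum_cons, Function.update_self, hne p hp]
      rw [List.map_congr_left (g := fun e => excess (len Is It e.1 e.2) (val Is It e.1 (x e.1))
        (val Is It e.2 (x e.2))) fun e he => by
          rw [hne _ (hM.mem_of_mem e he).1, hne _ (hM.mem_of_mem e he).2]]
      rw [hsum, hb] at hK
      unfold cand at hK
      omega

/-- The sum of the tables at an index grows by at most one when a leaf is removed. -/
theorem sum_absorb_le (hp : p ∈ A) (hc : c ∉ A)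
    (hpar : (len Is It p c + par Is It p + par Is It c) % 2 = 0) (i : ℕ) :
    ∑ v ∈ A, absorb Is It N F p c v i ≤ ∑ v ∈ insert c A, F v i + 1 := by
  rw [sum_insert hc, ← add_sum_erase _ _ hp, ← add_sum_erase _ (fun v => F v i) hp]
  have : ∑ v ∈ A.erase p, absorb Is It N F p c v i = ∑ v ∈ A.erase p, F v i := by
    refine sum_congr rfl fun v hv => ?_
    rw [absorb, Function.update_of_ne (ne_of_mem_erase hv)]
  rw [this, absorb, Function.update_self]
  have := best_le (N := N) (F := F) i hpar
  omega

theorem feasible_nil_iff :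
    Feasible Is It r N F [] {r} K ↔ ∃ i, i ≤ N ∧ val Is It r i + F r i ≤ K := by
  constructor
  · rintro ⟨x, hx, -, hK⟩
    exact ⟨x r, hx r, by simpa using hK⟩
  · rintro ⟨i, hi, hK⟩
    exact ⟨fun _ => i, fun _ => hi, by simp, by simpa using hK⟩

/-- `It` can be reached from `Is` within `K` flips exactly if there are feasible indices. -/
theorem symISR_iff_feasible [Fintype V] (hM : Grows r M univ)
    (hadj : ∀ u v, G.Adj u v ↔ (u, v) ∈ M ∨ (v, u) ∈ M)
    (hIs : G.IsIndepSet (Is : Set V)) (hIt : G.IsIndepSet (It : Set V)) :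
    G.SymISR (Is : Set V) (It : Set V) K ↔
      Feasible Is It r (Fintype.card V) (fun _ _ => 0) M univ K := by
  constructor
  · intro h
    obtain ⟨ρ, hN, hρ, hc⟩ := exists_profile_of_symISR hM hadj hIs hIt h
    have hval : ∀ v, val Is It v (ρ v / 2) = ρ v := by
      intro v
      have := hρ.parity v
      unfold val
      omega
    refine ⟨fun v => ρ v / 2, fun v => (Nat.div_le_self _ _).trans (hN v), fun e he => ?_, ?_⟩
    · unfold Close
      rw [hval, hval]
      exact hρ.lip e he
    · simp only [hval, sum_const_zero, Nat.add_zero]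
      exact hc
  · rintro ⟨x, -, hcl, hK⟩
    refine symISR_mono (symISR_of_profile hM hadj hIs hIt (ρ := fun v => val Is It v (x v))
      ⟨fun v => ?_, fun e he => hcl e he⟩) (by simpa [cost] using hK)
    have := par_le_one (Is := Is) (It := It) v
    simp only [val]
    omega

end

/-! ### Growing a spanning tree along the edge list -/

section

variable {V : Type*} [DecidableEq V] {G : SimpleGraph V} {A : Finset V} {M : List (V × V)} {r : V}

theorem Grows.nodup (h : Grows r M A) : (M.map fun e => s(e.1, e.2)).Nodup := by
  induction h with
  | nil => simp
  | @cons M A p c hG _ hc ih =>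
    rw [List.map_cons, List.nodup_cons]
    refine ⟨fun hmem => ?_, ih⟩
    obtain ⟨e, he, heq⟩ := List.mem_map.1 hmem
    have h1 := hG.mem_of_mem e he
    have h2 : c ∈ s(e.1, e.2) := by rw [heq]; simp
    rcases Sym2.mem_iff.1 h2 with h | h
    · exact hc (h ▸ h1.1)
    · exact hc (h ▸ h1.2)

/-- All edges of a tree are used when it is grown from a root. -/
theorem Grows.adj_iff [Fintype V] (hG : G.IsTree) (hM : Grows r M univ)
    (hadj : ∀ e ∈ M, G.Adj e.1 e.2) (u v : V) : G.Adj u v ↔ (u, v) ∈ M ∨ (v, u) ∈ M := by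
  classical
  constructor
  · intro huv
    have h1 := hG.card_edgeFinset
    have h2 := hM.card_eq
    rw [card_univ] at h2
    have hsub : (M.map fun e => s(e.1, e.2)).toFinset ⊆ G.edgeFinset := by
      intro e he
      rw [List.mem_toFinset, List.mem_map] at he
      obtain ⟨e', he', rfl⟩ := he
      rw [SimpleGraph.mem_edgeFinset, SimpleGraph.mem_edgeSet]
      exact hadj e' he'
    have heq := eq_of_subset_of_card_le hsub (by
      rw [List.toFinset_card_of_nodup hM.nodup, List.length_map]; omega)
    have h3 : s(u, v) ∈ G.edgeFinset := by
      rw [SimpleGraph.mem_edgeFinset, SimpleGraph.mem_edgeSet]; exact huv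
    rw [← heq, List.mem_toFinset, List.mem_map] at h3
    obtain ⟨⟨a, b⟩, he, h4⟩ := h3
    rcases Sym2.eq_iff.1 h4 with ⟨h5, h6⟩ | ⟨h5, h6⟩ <;> simp only at h5 h6 <;> subst h5 h6
    · exact Or.inl he
    · exact Or.inr he
  · rintro (h | h)
    · exact hadj _ h
    · exact (hadj _ h).symm

theorem length_of_isEdgeList [Fintype V] (hG : G.IsTree) {es : List (V × V)}
    (hes : G.IsEdgeList es) : es.length + 1 = Fintype.card V := by
  classical
  rw [← hG.card_edgeFinset]
  congr 1
  have : (es.map fun e => s(e.1, e.2)).toFinset = G.edgeFinset := by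
    ext e
    induction e with
    | _ a b =>
      rw [SimpleGraph.mem_edgeFinset, SimpleGraph.mem_edgeSet, hes.1, List.mem_toFinset,
        List.mem_map]
      constructor
      · rintro ⟨⟨u, v⟩, he, h⟩
        rcases Sym2.eq_iff.1 h with ⟨h5, h6⟩ | ⟨h5, h6⟩ <;> simp only at h5 h6 <;> subst h5 h6
        · exact Or.inl he
        · exact Or.inr he
      · rintro (h | h)
        · exact ⟨_, h, rfl⟩
        · exact ⟨_, h, Sym2.eq_swap⟩
  rw [← this, List.toFinset_card_of_nodup hes.2, List.length_map]

end

/-- In a connected graph, a set that contains a vertex and is not left by an edge is everything. -/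
theorem eq_univ_of_closed {V : Type*} [Fintype V] {G : SimpleGraph V}
    {A : Finset V} {r : V} (hG : G.Connected) (hr : r ∈ A)
    (h : ∀ u v, G.Adj u v → u ∈ A → v ∈ A) : A = univ := by
  rw [eq_univ_iff_forall]
  intro v
  obtain ⟨w⟩ := hG.preconnected r v
  induction w with
  | nil => exact hr
  | cons huv _ ih => exact ih (h _ _ huv hr)

open WordRAM

/-! ### Reasoning about word RAM programs -/

/-- Program `p`, started in `s` on a machine with `w`-bit words, halts after at most `T` steps in a
state that satisfies `Q`. -/
def Ends (w : ℕ) (p : Prog) (T : ℕ) (s : State) (Q : State → Prop) : Prop :=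
  ∃ t s', t ≤ T ∧ Run w p s t s' ∧ Q s'

/-- The programs of a list, one after the other. -/
def block : List Prog → Prog
  | [] => .skip
  | p :: ps => .seq p (block ps)

/-- The state `s` with the value of register `d` replaced by `v`. -/
def setReg (s : State) (d v : ℕ) : State := { s with reg := Function.update s.reg d v }

/-- The state `s` with the content of memory cell `x` replaced by `v`. -/
def setMem (s : State) (x v : ℕ) : State := { s with mem := Function.update s.mem x v }

section

variable {w : ℕ} {p q : Prog} {ps : List Prog} {T T' a b d : ℕ} {s : State} {Q R : State → Prop}

@[simp] theorem setReg_reg (s : State) (d v r : ℕ) :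
    (setReg s d v).reg r = if r = d then v else s.reg r := by
  simp [setReg, Function.update_apply]

@[simp] theorem setReg_mem (s : State) (d v : ℕ) : (setReg s d v).mem = s.mem := rfl

@[simp] theorem setMem_mem (s : State) (y v x : ℕ) :
    (setMem s y v).mem x = if x = y then v else s.mem x := by
  simp [setMem, Function.update_apply]

@[simp] theorem setMem_reg (s : State) (x v : ℕ) : (setMem s x v).reg = s.reg := rfl

theorem Ends.mono (h : Ends w p T s Q) (hT : T ≤ T') (hQ : ∀ s, Q s → R s) : Ends w p T' s R := by
  obtain ⟨t, s', ht, hr, hq⟩ := h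
  exact ⟨t, s', ht.trans hT, hr, hQ _ hq⟩

theorem ends_skip (h : Q s) : Ends w .skip 1 s Q := ⟨1, s, le_rfl, .skip s, h⟩

theorem ends_nil (h : Q s) : Ends w (block []) 1 s Q := ends_skip h

theorem ends_cons (h : Ends w p T s fun s' => Ends w (block ps) T' s' Q) :
    Ends w (block (p :: ps)) (T + T') s Q := by
  obtain ⟨t, s', ht, hr, t', s'', ht', hr', hq⟩ := h
  exact ⟨t + t', s'', by omega, .seq hr hr', hq⟩

theorem ends_ite (h1 : s.reg a ≠ 0 → Ends w p T s Q) (h2 : s.reg a = 0 → Ends w q T s Q) :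
    Ends w (.ite a p q) (T + 1) s Q := by
  by_cases h : s.reg a = 0
  · obtain ⟨t, s', ht, hr, hq⟩ := h2 h
    exact ⟨1 + t, s', by omega, .ite_false h hr, hq⟩
  · obtain ⟨t, s', ht, hr, hq⟩ := h1 h
    exact ⟨1 + t, s', by omega, .ite_true h hr, hq⟩

/-- A loop whose test register counts down. -/
theorem ends_while (Inv : ℕ → State → Prop) (T : ℕ)
    (hstep : ∀ i s, Inv (i + 1) s → s.reg a ≠ 0 ∧ Ends w p T s (Inv i))
    (h0 : ∀ s, Inv 0 s → s.reg a = 0) (m : ℕ) :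
    ∀ s, Inv m s → Ends w (.while a p) (m * (T + 1) + 1) s (Inv 0) := by
  induction m with
  | zero => exact fun s hs => ⟨1, s, by omega, .while_false (h0 s hs), hs⟩
  | succ m ih =>
    intro s hs
    obtain ⟨hne, t, s', ht, hr, hi⟩ := hstep m s hs
    obtain ⟨t', s'', ht', hr', hq⟩ := ih s' hi
    refine ⟨1 + t + t', s'', ?_, .while_true hne hr hr', hq⟩
    rw [Nat.succ_mul]
    omega

theorem ends_const (v : ℕ) (hv : v < 2 ^ w) (h : Ends w (block ps) T (setReg s d v) Q) :
    Ends w (block (.const d v :: ps)) (T + 1) s Q := by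
  rw [Nat.add_comm]
  refine ends_cons ⟨1, _, le_rfl, .const d v s, ?_⟩
  rw [Nat.mod_eq_of_lt hv]
  exact h

theorem ends_add (v : ℕ) (hv : s.reg a + s.reg b = v) (hlt : v < 2 ^ w)
    (h : Ends w (block ps) T (setReg s d v) Q) :
    Ends w (block (.op .add d a b :: ps)) (T + 1) s Q := by
  rw [Nat.add_comm]
  refine ends_cons ⟨1, _, le_rfl, .op .add d a b s, ?_⟩
  simp only [Op.eval, hv, Nat.mod_eq_of_lt hlt]
  exact h

theorem ends_mul (v : ℕ) (hv : s.reg a * s.reg b = v) (hlt : v < 2 ^ w)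
    (h : Ends w (block ps) T (setReg s d v) Q) :
    Ends w (block (.op .mul d a b :: ps)) (T + 1) s Q := by
  rw [Nat.add_comm]
  refine ends_cons ⟨1, _, le_rfl, .op .mul d a b s, ?_⟩
  simp only [Op.eval, hv, Nat.mod_eq_of_lt hlt]
  exact h

theorem ends_sub (v : ℕ) (hv : s.reg a - s.reg b = v)
    (h : Ends w (block ps) T (setReg s d v) Q) :
    Ends w (block (.op .sub d a b :: ps)) (T + 1) s Q := by
  rw [Nat.add_comm]
  refine ends_cons ⟨1, _, le_rfl, .op .sub d a b s, ?_⟩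
  simp only [Op.eval, hv]
  exact h

theorem ends_lt (v : ℕ) (hv : (if s.reg a < s.reg b then 1 else 0) = v)
    (h : Ends w (block ps) T (setReg s d v) Q) :
    Ends w (block (.op .lt d a b :: ps)) (T + 1) s Q := by
  rw [Nat.add_comm]
  refine ends_cons ⟨1, _, le_rfl, .op .lt d a b s, ?_⟩
  simp only [Op.eval, hv]
  exact h

theorem ends_eq (v : ℕ) (hv : (if s.reg a = s.reg b then 1 else 0) = v)
    (h : Ends w (block ps) T (setReg s d v) Q) :
    Ends w (block (.op .eq d a b :: ps)) (T + 1) s Q := by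
  rw [Nat.add_comm]
  refine ends_cons ⟨1, _, le_rfl, .op .eq d a b s, ?_⟩
  simp only [Op.eval, hv]
  exact h

theorem ends_load (v : ℕ) (hv : s.mem (s.reg a) = v)
    (h : Ends w (block ps) T (setReg s d v) Q) :
    Ends w (block (.load d a :: ps)) (T + 1) s Q := by
  rw [Nat.add_comm]
  refine ends_cons ⟨1, _, le_rfl, .load d a s, ?_⟩
  rw [hv]
  exact h

theorem ends_store (x v : ℕ) (hx : s.reg a = x) (hv : s.reg b = v)
    (h : Ends w (block ps) T (setMem s x v) Q) :
    Ends w (block (.store a b :: ps)) (T + 1) s Q := by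
  rw [Nat.add_comm]
  refine ends_cons ⟨1, _, le_rfl, .store a b s, ?_⟩
  rw [hx, hv]
  exact h

end

/-! ### The program -/

/-- Computes the constants `1, 2n, 4n, 5n, 8n, n + 1` in the registers `2, …, 7`, where register `8`
is always `0`; marks the root `0` as visited and sets the number of rounds. The marks of the
vertices begin at address `4n`, the list of attached pairs at `5n`, and the tables at `8n`. -/
def setup : Prog := block
  [.const 2 1, .op .add 3 0 0, .op .add 4 3 3, .op .add 5 4 0, .op .add 6 4 4, .op .add 7 0 2,
    .store 4 2, .op .add 11 0 8]

/-- Attaches the vertex in register `14` to the one in register `13`. -/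
def attach : Prog := block
  [.op .add 24 10 10, .op .add 24 24 5, .store 24 13, .op .add 24 24 2, .store 24 14,
    .op .add 24 4 14, .store 24 2, .op .add 10 10 2]

/-- Exchanges the registers `13` and `14`. -/
def swap : Prog := block [.op .add 24 13 8, .op .add 13 14 8, .op .add 14 24 8]

/-- Reads the next edge of the input, and attaches one end to the other if exactly the latter has
been visited. -/
def scan : Prog := block
  [.op .sub 12 12 2, .op .add 24 12 12, .op .add 24 24 3, .load 13 24, .op .add 24 24 2,
    .load 14 24, .op .add 24 4 13, .load 25 24, .op .add 24 4 14, .load 26 24, .op .eq 27 25 26,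
    .ite 27 .skip (block [.ite 25 .skip swap, attach])]

/-- Grows a spanning tree from the root, in `n` rounds through the edge list. -/
def grow : Prog := .while 11 (block [.op .sub 11 11 2, .op .sub 12 0 2, .while 12 scan])

/-- For the pair of vertices under consideration, with the number of flips of the parent in register
`21` and the table index of the child in register `22`: computes the cost of this choice in register
`27`, and `0` in register `28` if it is admissible. -/
def probe : Prog := block
  [.op .add 24 22 22, .op .add 24 24 16, .op .sub 25 24 21, .op .sub 26 21 24, .op .add 28 25 26,
    .op .lt 28 17 28, .op .sub 26 21 26, .op .eq 25 21 24, .op .mul 25 25 18, .op .sub 26 26 25,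
    .op .sub 26 24 26, .op .add 27 20 22, .load 27 27, .op .add 27 27 26]

/-- Updates the best cost, in register `23`, by the result of `probe`. -/
def take : Prog :=
  .ite 28 .skip (block [.op .lt 28 27 23, .ite 28 (block [.op .add 23 27 8]) .skip])

/-- Adds the least cost of the child to one entry of the table of its parent. -/
def entry : Prog := block
  [.op .sub 12 12 2, .op .add 21 12 12, .op .add 21 21 15, .op .add 22 12 8, probe,
    .op .add 23 27 8, .op .sub 22 12 2, probe, take, .op .lt 22 12 0, .op .add 22 12 22, probe,
    take, .op .add 24 19 12, .load 25 24, .op .add 25 25 23, .store 24 25]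

/-- Reads the last pair of the list and prepares the removal of the child: the parities of parent
and child, the length of the edge, and the addresses of the two tables. -/
def prepare : Prog := block
  [.op .sub 10 10 2, .op .add 24 10 10, .op .add 24 24 5, .load 13 24, .op .add 24 24 2,
    .load 14 24, .load 25 13, .op .add 24 0 13, .load 26 24, .load 27 14, .op .add 24 0 14,
    .load 28 24, .op .eq 15 25 26, .op .sub 15 2 15, .op .eq 16 27 28, .op .sub 16 2 16,
    .op .add 25 25 27, .op .eq 25 25 8, .op .add 26 26 28, .op .eq 26 26 8, .op .add 17 25 26,
    .op .lt 18 2 17, .op .mul 19 13 7, .op .add 19 19 6, .op .mul 20 14 7, .op .add 20 20 6,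
    .op .add 12 7 8]

/-- Removes the vertices of the tree one after the other, the last one attached first. -/
def shrink : Prog := .while 10 (block [prepare, .while 12 entry])

/-- Sets register `9` to `1` if the index in register `12` is good enough at the root. -/
def test : Prog := block
  [.op .sub 12 12 2, .op .add 24 12 12, .op .add 24 24 15, .op .add 25 6 12, .load 25 25,
    .op .add 25 25 24, .op .lt 25 1 25, .ite 25 .skip (block [.const 9 1])]

/-- Decides whether some index at the root is good enough. -/
def decideRoot : Prog := block
  [.load 13 8, .load 14 0, .op .eq 15 13 14, .op .sub 15 2 15, .op .add 12 7 8, .while 12 test,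
    .op .add 0 9 8]

/-- The program that solves the problem. -/
def solve : Prog := block [setup, grow, shrink, decideRoot]

/-! ### Removing the leaves -/

/-- The registers and cells that hold the constants and the input throughout the computation. -/
structure Ready {n : ℕ} (Is It : Finset (Fin n)) (k : ℕ) (s : State) : Prop where
  r0 : s.reg 0 = n
  r1 : s.reg 1 = k
  r2 : s.reg 2 = 1
  r3 : s.reg 3 = 2 * n
  r4 : s.reg 4 = 4 * n
  r5 : s.reg 5 = 5 * n
  r6 : s.reg 6 = 8 * n
  r7 : s.reg 7 = n + 1
  r8 : s.reg 8 = 0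
  memIs : ∀ v : Fin n, s.mem v = if v ∈ Is then 1 else 0
  memIt : ∀ v : Fin n, s.mem (n + v) = if v ∈ It then 1 else 0

/-- The pairs of `M` are stored from address `x` on, the last one attached at the end. -/
def Stored {n : ℕ} (mem : ℕ → ℕ) (x : ℕ) : List (Fin n × Fin n) → Prop
  | [] => True
  | e :: M => mem (x + 2 * M.length) = e.1 ∧ mem (x + 2 * M.length + 1) = e.2 ∧ Stored mem x M

/-- The address of the table of the vertex `v`. -/
def row {n : ℕ} (v : Fin n) : ℕ := 8 * n + v * (n + 1)

/-- The tables of the vertices are stored at their addresses. -/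
def Tables {n : ℕ} (mem : ℕ → ℕ) (F : Fin n → ℕ → ℕ) : Prop :=
  ∀ (v : Fin n) (i : ℕ), i ≤ n → mem (row v + i) = F v i

section

variable {n k w : ℕ} {Is It : Finset (Fin n)}

theorem Ready.of_eq {s s' : State} (h : Ready Is It k s) (hr : ∀ r, r ≤ 8 → s'.reg r = s.reg r)
    (hm : ∀ x, x < 2 * n → s'.mem x = s.mem x) : Ready Is It k s' where
  r0 := by rw [hr 0 (by omega), h.r0]
  r1 := by rw [hr 1 (by omega), h.r1]
  r2 := by rw [hr 2 (by omega), h.r2]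
  r3 := by rw [hr 3 (by omega), h.r3]
  r4 := by rw [hr 4 (by omega), h.r4]
  r5 := by rw [hr 5 (by omega), h.r5]
  r6 := by rw [hr 6 (by omega), h.r6]
  r7 := by rw [hr 7 (by omega), h.r7]
  r8 := by rw [hr 8 (by omega), h.r8]
  memIs := fun v => by rw [hm v (by have := v.2; omega), h.memIs]
  memIt := fun v => by rw [hm (n + v) (by have := v.2; omega), h.memIt]

theorem Stored.of_eq {mem mem' : ℕ → ℕ} {x : ℕ} {M : List (Fin n × Fin n)} (h : Stored mem x M)
    (hm : ∀ y, x ≤ y → y < x + 2 * M.length → mem' y = mem y) : Stored mem' x M := by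
  induction M with
  | nil => trivial
  | cons e M ih =>
    obtain ⟨h1, h2, h3⟩ := h
    rw [List.length_cons] at hm
    exact ⟨by rw [hm _ (by omega) (by omega), h1], by rw [hm _ (by omega) (by omega), h2],
      ih h3 fun y hy hy' => hm y hy (by omega)⟩

theorem row_add_le (v : Fin n) : row v + (n + 1) ≤ 8 * n + n * (n + 1) := by
  have := Nat.mul_le_mul_right (n + 1) (Nat.succ_le_of_lt v.2)
  rw [Nat.succ_mul] at this
  unfold row
  omega

theorem row_inj {u v : Fin n} {i j : ℕ} (hi : i ≤ n) (hj : j ≤ n) (h : row u + i = row v + j) :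
    u = v ∧ i = j := by
  unfold row at h
  have huv : (u : ℕ) = v := by
    rcases lt_trichotomy (u : ℕ) v with hlt | heq | hlt
    · have := Nat.mul_le_mul_right (n + 1) (Nat.succ_le_of_lt hlt)
      rw [Nat.succ_mul] at this
      omega
    · exact heq
    · have := Nat.mul_le_mul_right (n + 1) (Nat.succ_le_of_lt hlt)
      rw [Nat.succ_mul] at this
      omega
  refine ⟨Fin.ext huv, ?_⟩
  rw [huv] at h
  omega

/-- `probe` computes `excess` by truncated subtraction, from `min a b = a - (a - b)`. -/
theorem ends_probe {s : State} {a j x ℓ y f : ℕ} (h21 : s.reg 21 = a) (h22 : s.reg 22 = j)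
    (h16 : s.reg 16 = x) (h17 : s.reg 17 = ℓ) (h18 : s.reg 18 = if ℓ = 2 then 1 else 0)
    (h20 : s.reg 20 = y) (hf : s.mem (y + j) = f) (hw1 : j + j + x + a < 2 ^ w)
    (hw2 : y + j < 2 ^ w) (hw3 : f + (j + j + x) < 2 ^ w) (hw4 : 1 < 2 ^ w) :
    Ends w probe 15 s fun s' => s'.mem = s.mem ∧ s'.reg 27 = f + excess ℓ a (j + j + x) ∧
      (s'.reg 28 = 0 ↔ (a ≤ j + j + x + ℓ ∧ j + j + x ≤ a + ℓ)) ∧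
      ∀ r, r < 24 → s'.reg r = s.reg r := by
  have hex : excess ℓ a (j + j + x) ≤ j + j + x := Nat.sub_le _ _
  unfold probe
  refine ends_add (j + j) (by simp [h22]) (by omega) ?_
  refine ends_add (j + j + x) (by simp [h16]) (by omega) ?_
  refine ends_sub (j + j + x - a) (by simp [h21]) ?_
  refine ends_sub (a - (j + j + x)) (by simp [h21]) ?_
  refine ends_add (j + j + x - a + (a - (j + j + x))) (by simp) (by omega) ?_
  refine ends_lt (if ℓ < j + j + x - a + (a - (j + j + x)) then 1 else 0) (by simp [h17]) ?_
  refine ends_sub (min a (j + j + x)) (by simp [h21]; omega) ?_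
  refine ends_eq (if a = j + j + x then 1 else 0) (by simp [h21]) ?_
  refine ends_mul (if ℓ = 2 ∧ a = j + j + x then 1 else 0)
    (by simp [h18]; split_ifs <;> simp_all) (by split_ifs <;> omega) ?_
  refine ends_sub (shared ℓ a (j + j + x)) (by simp [shared]) ?_
  refine ends_sub (excess ℓ a (j + j + x)) (by simp [excess]) ?_
  refine ends_add (y + j) (by simp [h20, h22]) (by omega) ?_
  refine ends_load f (by simp [hf]) ?_
  refine ends_add (f + excess ℓ a (j + j + x)) (by simp) (by omega) ?_
  refine ends_nil ⟨rfl, by simp, ?_, fun r hr => ?_⟩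
  · simp
    omega
  · simp only [setReg_reg]
    repeat rw [if_neg (by omega)]

theorem ends_take {s : State} {x y : ℕ} (h8 : s.reg 8 = 0) (h23 : s.reg 23 = x)
    (h27 : s.reg 27 = y) (hy : y < 2 ^ w) :
    Ends w take 6 s fun s' => s'.mem = s.mem ∧
      s'.reg 23 = (if s.reg 28 = 0 ∧ y < x then y else x) ∧
      ∀ r, r < 24 → r ≠ 23 → s'.reg r = s.reg r := by
  unfold take
  refine ends_ite (fun h => ?_) (fun h => ?_)
  · refine (ends_skip ⟨rfl, ?_, fun _ _ _ => rfl⟩).mono (by omega) fun _ h => h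
    rw [if_neg (by tauto), h23]
  · refine ends_lt (T := 4) (if y < x then 1 else 0) (by simp [h23, h27]) ?_
    refine ends_cons (T := 3) (T' := 1) (ends_ite (fun h' => ?_) (fun h' => ?_))
    · simp only [setReg_reg, if_true] at h'
      refine ends_add y (by simp [h8, h27]) hy (ends_nil ?_)
      refine ends_nil ⟨rfl, ?_, fun r hr hr' => ?_⟩
      · simp only [setReg_reg, if_true]
        rw [if_pos ⟨h, by by_contra hc; simp [hc] at h'⟩]
      · simp only [setReg_reg]
        repeat rw [if_neg (by omega)]
    · simp only [setReg_reg, if_true] at h'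
      refine (ends_skip ?_).mono (by omega : 1 ≤ 2) fun _ h => h
      refine ends_nil ⟨rfl, ?_, fun r hr hr' => ?_⟩
      · simp only [setReg_reg]
        rw [if_neg (by omega), if_neg (fun hc => by simp [hc.2] at h'), h23]
      · simp only [setReg_reg]
        repeat rw [if_neg (by omega)]

/-- The registers describe the pair `(p, c)`. -/
structure Prepared (Is It : Finset (Fin n)) (p c : Fin n) (s : State) : Prop where
  r15 : s.reg 15 = par Is It p
  r16 : s.reg 16 = par Is It c
  r17 : s.reg 17 = len Is It p c
  r18 : s.reg 18 = if len Is It p c = 2 then 1 else 0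
  r19 : s.reg 19 = row p
  r20 : s.reg 20 = row c

theorem Prepared.of_eq {p c : Fin n} {s s' : State} (h : Prepared Is It p c s)
    (hr : ∀ r, 15 ≤ r → r ≤ 20 → s'.reg r = s.reg r) : Prepared Is It p c s' where
  r15 := by rw [hr 15 (by omega) (by omega), h.r15]
  r16 := by rw [hr 16 (by omega) (by omega), h.r16]
  r17 := by rw [hr 17 (by omega) (by omega), h.r17]
  r18 := by rw [hr 18 (by omega) (by omega), h.r18]
  r19 := by rw [hr 19 (by omega) (by omega), h.r19]
  r20 := by rw [hr 20 (by omega) (by omega), h.r20]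

theorem ends_probe_index (hw : 16 * n + n * (n + 1) + 16 ≤ 2 ^ w) {p c : Fin n} {s : State}
    (hP : Prepared Is It p c s) {F : Fin n → ℕ → ℕ} {i j : ℕ} (hi : i ≤ n) (hj : j ≤ n)
    (h21 : s.reg 21 = val Is It p i) (h22 : s.reg 22 = j) (hF : s.mem (row c + j) = F c j)
    (hB : F c j ≤ n) :
    Ends w probe 15 s fun s' => s'.mem = s.mem ∧ s'.reg 27 = cand Is It F p c i j ∧
      (s'.reg 28 = 0 ↔ Close Is It p c i j) ∧ cand Is It F p c i j < 2 ^ w ∧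
      ∀ r, r < 24 → s'.reg r = s.reg r := by
  have h1 := par_le_one (Is := Is) (It := It) p
  have h2 := par_le_one (Is := Is) (It := It) c
  have h3 := row_add_le c
  have h4 : excess (len Is It p c) (val Is It p i) (val Is It c j) ≤ val Is It c j :=
    Nat.sub_le _ _
  refine (ends_probe h21 h22 hP.r16 hP.r17 hP.r18 hP.r20 hF (by unfold val; omega) (by omega)
    (by omega) (by omega)).mono le_rfl ?_
  rintro s' ⟨a, b, c', d⟩
  refine ⟨a, b, c', ?_, d⟩
  unfold cand
  unfold val at h4 ⊢
  omega

theorem ends_entry (hw : 16 * n + n * (n + 1) + 16 ≤ 2 ^ w) {p c : Fin n} {s : State}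
    (hR : Ready Is It k s) (hP : Prepared Is It p c s) {F : Fin n → ℕ → ℕ} {i : ℕ} (hi : i ≤ n)
    (h12 : s.reg 12 = i + 1) (hF : ∀ j, j ≤ n → s.mem (row c + j) = F c j)
    (hFp : s.mem (row p + i) = F p i) (hB : ∀ j, j ≤ n → F c j ≤ n) (hBp : F p i ≤ n)
    (hpar : (len Is It p c + par Is It p + par Is It c) % 2 = 0) :
    Ends w entry 70 s fun s' =>
      s'.mem = Function.update s.mem (row p + i) (absorb Is It n F p c p i) ∧
      s'.reg 12 = i ∧ ∀ r, r < 21 → r ≠ 12 → s'.reg r = s.reg r := by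
  have b1 := par_le_one (Is := Is) (It := It) p
  have b3 := row_add_le p
  have b4 := best_le (N := n) (F := F) i hpar
  have b5 := hB i hi
  unfold entry
  refine ends_sub i (by simp [h12, hR.r2]) ?_
  refine ends_add (i + i) (by simp) (by omega) ?_
  refine ends_add (val Is It p i) (by simp [hP.r15, val]) (by unfold val; omega) ?_
  refine ends_add i (by simp [hR.r8]) (by omega) ?_
  refine ends_cons (T' := 51) ((ends_probe_index hw (F := F) (i := i) (j := i)
    (hP.of_eq fun r h1 h2 => ?_) hi hi (by simp) (by simp) (by simpa using hF i hi)
    (hB i hi)).mono le_rfl ?_)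
  · simp only [setReg_reg]
    repeat rw [if_neg (by omega)]
  rintro s1 ⟨m1, c1, -, l1, f1⟩
  have q1 : ∀ r, r < 21 → r ≠ 12 → s1.reg r = s.reg r := by
    intro r h1 h2
    rw [f1 r (by omega)]
    simp only [setReg_reg]
    repeat rw [if_neg (by omega)]
  have s1_12 : s1.reg 12 = i := by rw [f1 12 (by omega)]; simp
  have s1_21 : s1.reg 21 = val Is It p i := by rw [f1 21 (by omega)]; simp
  have m1' : s1.mem = s.mem := m1
  clear f1 m1
  refine ends_add (cand Is It F p c i i) (by simp [c1, q1 8, hR.r8]) (by omega) ?_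
  refine ends_sub (i - 1) (by simp [s1_12, q1 2, hR.r2]) ?_
  refine ends_cons (T' := 34) ((ends_probe_index hw (F := F) (i := i) (j := i - 1)
    (hP.of_eq fun r h1 h2 => ?_) hi (by omega) (by simpa using s1_21) (by simp)
    (by simpa [m1'] using hF (i - 1) (by omega)) (hB _ (by omega))).mono le_rfl ?_)
  · simp only [setReg_reg]
    rw [if_neg (by omega), if_neg (by omega), q1 r (by omega) (by omega)]
  rintro s2 ⟨m2, c2, d2, l2, f2⟩
  have q2 : ∀ r, r < 21 → r ≠ 12 → s2.reg r = s.reg r := by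
    intro r h1 h2
    rw [f2 r (by omega)]
    simp only [setReg_reg]
    rw [if_neg (by omega), if_neg (by omega), q1 r (by omega) (by omega)]
  refine ends_cons (T' := 28) ((ends_take (x := cand Is It F p c i i)
    (by rw [q2 8 (by omega) (by omega), hR.r8]) (by rw [f2 23 (by omega)]; simp) c2 l2).mono
      le_rfl ?_)
  rintro s3 ⟨m3, c3, f3⟩
  have q3 : ∀ r, r < 21 → r ≠ 12 → s3.reg r = s.reg r := fun r h1 h2 => by
    rw [f3 r (by omega) (by omega), q2 r h1 h2]
  have s3_12 : s3.reg 12 = i := by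
    rw [f3 12 (by omega) (by omega), f2 12 (by omega)]; simp [s1_12]
  have s3_21 : s3.reg 21 = val Is It p i := by
    rw [f3 21 (by omega) (by omega), f2 21 (by omega)]; simp [s1_21]
  have s3_23 : s3.reg 23 = improve Is It F p c i (i - 1) (cand Is It F p c i i) := by
    rw [c3]
    exact if_congr (and_congr_left' d2) rfl rfl
  have m3' : s3.mem = s.mem := by rw [m3, m2]; exact m1'
  clear f3 f2 m3 m2 c3
  have hj : (i + if i < n then 1 else 0) ≤ n := by split_ifs <;> omega
  refine ends_lt (if i < n then 1 else 0) (by simp [s3_12, q3 0, hR.r0]) ?_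
  refine ends_add (i + if i < n then 1 else 0) (by simp [s3_12]) (by omega) ?_
  refine ends_cons (T' := 11) ((ends_probe_index hw (F := F) (i := i)
    (j := i + if i < n then 1 else 0) (hP.of_eq fun r h1 h2 => ?_) hi hj (by simpa using s3_21)
    (by simp) (by simpa only [setReg_mem, m3'] using hF _ hj) (hB _ hj)).mono le_rfl ?_)
  · simp only [setReg_reg]
    rw [if_neg (by omega), if_neg (by omega), q3 r (by omega) (by omega)]
  rintro s4 ⟨m4, c4, d4, l4, f4⟩
  have q4 : ∀ r, r < 21 → r ≠ 12 → s4.reg r = s.reg r := by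
    intro r h1 h2
    rw [f4 r (by omega)]
    simp only [setReg_reg]
    rw [if_neg (by omega), if_neg (by omega), q3 r (by omega) (by omega)]
  refine ends_cons (T' := 5) ((ends_take
    (x := improve Is It F p c i (i - 1) (cand Is It F p c i i))
    (by rw [q4 8 (by omega) (by omega), hR.r8]) (by rw [f4 23 (by omega)]; simpa using s3_23)
    c4 l4).mono le_rfl ?_)
  rintro s5 ⟨m5, c5, f5⟩
  have q5 : ∀ r, r < 21 → r ≠ 12 → s5.reg r = s.reg r := fun r h1 h2 => by
    rw [f5 r (by omega) (by omega), q4 r h1 h2]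
  have s5_12 : s5.reg 12 = i := by
    rw [f5 12 (by omega) (by omega), f4 12 (by omega)]; simp [s3_12]
  have s5_23 : s5.reg 23 = best Is It n F p c i := by
    rw [c5]
    exact if_congr (and_congr_left' d4) rfl rfl
  have m5' : s5.mem = s.mem := by rw [m5, m4]; exact m3'
  refine ends_add (row p + i) (by simp [s5_12, q5 19, hP.r19]) (by omega) ?_
  refine ends_load (F p i) (by simp [m5', hFp]) ?_
  refine ends_add (F p i + best Is It n F p c i) (by simp [s5_23]) (by omega) ?_
  refine ends_store (row p + i) (F p i + best Is It n F p c i) (by simp) (by simp) ?_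
  refine ends_nil ⟨?_, by simpa using s5_12, fun r h1 h2 => ?_⟩
  · simp only [setMem, setReg_mem, m5', absorb, Function.update_self]
  · simp only [setMem_reg, setReg_reg]
    rw [if_neg (by omega), if_neg (by omega), if_neg (by omega), q5 r h1 h2]

end

section

variable {n k w : ℕ} {Is It : Finset (Fin n)}

theorem card_add_two_le {A : Finset (Fin n)} {M : List (Fin n × Fin n)} {r c : Fin n}
    (hG : Grows r M A) (hc : c ∉ A) : M.length + 2 ≤ n := by
  have h1 := hG.card_eq
  have h2 := card_le_univ (insert c A)
  rw [card_insert_of_notMem hc, Fintype.card_fin] at h2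
  omega

theorem ends_prepare (hw : 16 * n + n * (n + 1) + 16 ≤ 2 ^ w) {p c : Fin n} {s : State}
    {M : List (Fin n × Fin n)} (hR : Ready Is It k s) (hS : Stored s.mem (5 * n) ((p, c) :: M))
    (h10 : s.reg 10 = M.length + 1) (hlen : M.length + 2 ≤ n) :
    Ends w prepare 28 s fun s' => s'.mem = s.mem ∧ s'.reg 10 = M.length ∧ s'.reg 12 = n + 1 ∧
      Prepared Is It p c s' ∧ ∀ r, r < 10 → s'.reg r = s.reg r := by
  obtain ⟨hp, hc, -⟩ := hS
  have rp := row_add_le p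
  have rc := row_add_le c
  have p2 := p.2
  have c2 := c.2
  simp only at hp hc
  have hxp : ∀ v : Fin n, 1 - (if (if v ∈ Is then 1 else 0 : ℕ) = if v ∈ It then 1 else 0
      then 1 else 0) = par Is It v := by
    intro v
    unfold par
    by_cases a : v ∈ Is <;> by_cases b : v ∈ It <;> simp [a, b]
  have hgap : ∀ S : Finset (Fin n), (if (if p ∈ S then 1 else 0 : ℕ) + (if c ∈ S then 1 else 0) = 0
      then 1 else 0) = gap S p c := by
    intro S
    unfold gap
    by_cases a : p ∈ S <;> by_cases b : c ∈ S <;> simp [a, b]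
  have hl := len_le_two (Is := Is) (It := It) p c
  unfold prepare
  refine ends_sub M.length (by simp [h10, hR.r2]) ?_
  refine ends_add (M.length + M.length) (by simp) (by omega) ?_
  refine ends_add (5 * n + 2 * M.length) (by simp [hR.r5]; omega) (by omega) ?_
  refine ends_load p (by simp [hp]) ?_
  refine ends_add (5 * n + 2 * M.length + 1) (by simp [hR.r2]) (by omega) ?_
  refine ends_load c (by simp [hc]) ?_
  refine ends_load (if p ∈ Is then 1 else 0) (by simp [hR.memIs]) ?_
  refine ends_add (n + p) (by simp [hR.r0]) (by omega) ?_
  refine ends_load (if p ∈ It then 1 else 0) (by simp [hR.memIt]) ?_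
  refine ends_load (if c ∈ Is then 1 else 0) (by simp [hR.memIs]) ?_
  refine ends_add (n + c) (by simp [hR.r0]) (by omega) ?_
  refine ends_load (if c ∈ It then 1 else 0) (by simp [hR.memIt]) ?_
  refine ends_eq _ rfl ?_
  refine ends_sub (par Is It p) (by rw [← hxp p]; simp [hR.r2]) ?_
  refine ends_eq _ rfl ?_
  refine ends_sub (par Is It c) (by rw [← hxp c]; simp [hR.r2]) ?_
  refine ends_add ((if p ∈ Is then 1 else 0) + (if c ∈ Is then 1 else 0)) (by simp)
    (by split_ifs <;> omega) ?_
  refine ends_eq (gap Is p c) (by rw [← hgap Is]; simp [hR.r8]) ?_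
  refine ends_add ((if p ∈ It then 1 else 0) + (if c ∈ It then 1 else 0)) (by simp)
    (by split_ifs <;> omega) ?_
  refine ends_eq (gap It p c) (by rw [← hgap It]; simp [hR.r8]) ?_
  refine ends_add (len Is It p c) (by simp [len]) (by omega) ?_
  refine ends_lt (if len Is It p c = 2 then 1 else 0)
    (by simp only [setReg_reg, hR.r2]; simp only [Nat.reduceEqDiff, if_true, if_false]
        split_ifs <;> omega) ?_
  refine ends_mul (p * (n + 1)) (by simp [hR.r7]) (by unfold row at rp; omega) ?_
  refine ends_add (row p) (by simp [hR.r6, row, Nat.add_comm]) (by omega) ?_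
  refine ends_mul (c * (n + 1)) (by simp [hR.r7]) (by unfold row at rc; omega) ?_
  refine ends_add (row c) (by simp [hR.r6, row, Nat.add_comm]) (by omega) ?_
  refine ends_add (n + 1) (by simp [hR.r7, hR.r8]) (by omega) ?_
  refine ends_nil ⟨rfl, by simp, by simp, ⟨by simp, by simp, by simp, by simp, by simp, by simp⟩,
    fun r hr => ?_⟩
  simp only [setReg_reg]
  repeat rw [if_neg (by omega)]

/-- The loop that adds the least costs of the leaf `c` to the table of its neighbour `p`. -/
theorem ends_entries (hw : 16 * n + n * (n + 1) + 16 ≤ 2 ^ w) {p c : Fin n} {s : State}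
    (hpc : p ≠ c) (hR : Ready Is It k s) (hP : Prepared Is It p c s) {F : Fin n → ℕ → ℕ}
    (h12 : s.reg 12 = n + 1) (hF : Tables s.mem F) (hBc : ∀ j, F c j ≤ n) (hBp : ∀ j, F p j ≤ n)
    (hpar : (len Is It p c + par Is It p + par Is It c) % 2 = 0) :
    Ends w (.while 12 entry) ((n + 1) * 71 + 1) s fun s' =>
      (∀ x, x < 8 * n → s'.mem x = s.mem x) ∧ Tables s'.mem (absorb Is It n F p c) ∧
      ∀ r, r < 12 → s'.reg r = s.reg r := by
  let Inv : ℕ → State → Prop := fun i s' => s'.reg 12 = i ∧ i ≤ n + 1 ∧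
    (∀ x, x < 8 * n → s'.mem x = s.mem x) ∧
    Tables s'.mem (fun v j => if i ≤ j then absorb Is It n F p c v j else F v j) ∧
    ∀ r, r < 21 → r ≠ 12 → s'.reg r = s.reg r
  refine (ends_while Inv 70 ?_ (fun s h => h.1) (n + 1) s ⟨h12, le_rfl, fun _ _ => rfl, ?_,
    fun _ _ _ => rfl⟩).mono le_rfl ?_
  · rintro i s1 ⟨h1, h2, h3, h4, h5⟩
    refine ⟨by omega, ?_⟩
    have hc : ∀ v j, v ≠ p → absorb Is It n F p c v j = F v j := by
      intro v j hv
      rw [absorb, Function.update_of_ne hv]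
    refine (ends_entry hw (hR.of_eq (fun r hr => h5 r (by omega) (by omega))
      fun x hx => h3 x (by omega)) (hP.of_eq fun r hr hr' => h5 r (by omega) (by omega))
      (i := i) (F := F) (by omega) h1 (fun j hj => ?_) ?_ (fun j _ => hBc j) (hBp i) hpar).mono
      le_rfl ?_
    · rw [h4 c j hj]
      simp only [hc c j hpc.symm, ite_self]
    · rw [h4 p i (by omega)]
      exact if_neg (by omega)
    · rintro s2 ⟨m2, c2, f2⟩
      refine ⟨c2, by omega, fun x hx => ?_, fun v j hj => ?_, fun r hr hr' => ?_⟩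
      · rw [m2, Function.update_of_ne (by unfold row; omega), h3 x hx]
      · rw [m2]
        by_cases hv : row v + j = row p + i
        · obtain ⟨rfl, rfl⟩ := row_inj hj (by omega) hv
          rw [Function.update_self]
          exact (if_pos le_rfl).symm
        · rw [Function.update_of_ne hv, h4 v j hj]
          by_cases hvp : v = p
          · have : j ≠ i := by
              rintro rfl; exact hv (by rw [hvp])
            simp only
            split_ifs <;> first | rfl | omega
          · simp only [hc v j hvp, ite_self]
      · rw [f2 r hr hr', h5 r hr hr']
  · intro v i hi
    rw [hF v i hi]
    exact (if_neg (by omega)).symm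
  · rintro s1 ⟨-, -, h3, h4, h5⟩
    refine ⟨h3, fun v j hj => ?_, fun r hr => h5 r (by omega) (by omega)⟩
    rw [h4 v j hj]
    exact if_pos (Nat.zero_le j)

/-- The state between two removals of leaves: the remaining tree is stored, and the tables, whose
entries are small, have preserved the answer `P`. -/
def Shrunk (Is It : Finset (Fin n)) (k : ℕ) (r : Fin n) (P : Prop) (m : ℕ) (s : State) : Prop :=
  Ready Is It k s ∧ s.reg 9 = 0 ∧ s.reg 10 = m ∧
  ∃ (A : Finset (Fin n)) (M : List (Fin n × Fin n)) (F : Fin n → ℕ → ℕ), Grows r M A ∧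
    M.length = m ∧ (∀ e ∈ M, (len Is It e.1 e.2 + par Is It e.1 + par Is It e.2) % 2 = 0) ∧
    Stored s.mem (5 * n) M ∧ Tables s.mem F ∧ (∀ i, ∑ v ∈ A, F v i + A.card ≤ n) ∧
    (Feasible Is It r n F M A k ↔ P)

/-- Each removal of a leaf takes time linear in `n`. -/
theorem ends_shrink (hw : 16 * n + n * (n + 1) + 16 ≤ 2 ^ w) {r : Fin n} {P : Prop} {m : ℕ}
    {s : State} (hs : Shrunk Is It k r P m s) :
    Ends w shrink (m * ((28 + ((n + 1) * 71 + 1 + 1)) + 1) + 1) s (Shrunk Is It k r P 0) := by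
  refine ends_while (Shrunk Is It k r P) _ ?_ (fun s h => h.2.2.1) m s hs
  rintro i s ⟨hR, h9, h10, A, M, F, hG, hlen, hpar, hS, hF, hB, hP⟩
  refine ⟨by omega, ?_⟩
  cases hG with
  | nil => simp at hlen
  | @cons M A p c hG hp hc =>
    rw [List.length_cons] at hlen
    have hpc : p ≠ c := fun h => hc (h ▸ hp)
    have hpar' := hpar (p, c) (by simp)
    have hle : ∀ v ∈ insert c A, ∀ j, F v j ≤ n := by
      intro v hv j
      have := single_le_sum (f := fun v => F v j) (fun _ _ => Nat.zero_le _) hv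
      have := hB j
      simp only at *
      omega
    refine ends_cons ((ends_prepare hw hR hS (by omega) (card_add_two_le hG hc)).mono le_rfl ?_)
    rintro s1 ⟨m1, h1_10, h1_12, hP1, f1⟩
    have hR1 : Ready Is It k s1 := hR.of_eq (fun r hr => f1 r (by omega)) fun x _ => by rw [m1]
    refine ends_cons ((ends_entries hw hpc hR1 hP1 h1_12 (by rwa [m1]) (hle c (by simp))
      (hle p (by simp [hp])) hpar').mono le_rfl ?_)
    rintro s2 ⟨m2, hF2, f2⟩
    have hn := card_add_two_le hG hc
    refine ends_nil ⟨hR1.of_eq (fun r hr => f2 r (by omega)) fun x hx => m2 x (by omega), ?_, ?_,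
      A, M, absorb Is It n F p c, hG, by omega, fun e he => hpar e (List.mem_cons_of_mem _ he),
      ?_, hF2, fun j => ?_, ?_⟩
    · rw [f2 9 (by omega), f1 9 (by omega), h9]
    · rw [f2 10 (by omega), h1_10]; omega
    · refine (hS.2.2).of_eq fun y _ hy => ?_
      rw [m2 y (by omega), m1]
    · have h1 := sum_absorb_le (N := n) (F := F) hp hc hpar' j
      have h2 := hB j
      rw [card_insert_of_notMem hc] at h2
      omega
    · rw [← hP, feasible_absorb_iff hG hp hc hpar']

/-! ### Reading off the answer -/

theorem ends_test (hw : 16 * n + n * (n + 1) + 16 ≤ 2 ^ w) {r : Fin n} (hr : (r : ℕ) = 0)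
    {s : State} (hR : Ready Is It k s) {i f : ℕ} (hi : i ≤ n) (h15 : s.reg 15 = par Is It r)
    (h12 : s.reg 12 = i + 1) (hf : s.mem (row r + i) = f) (hB : f ≤ n) :
    Ends w test 11 s fun s' => s'.mem = s.mem ∧ s'.reg 12 = i ∧ s'.reg 15 = s.reg 15 ∧
      s'.reg 9 = (if val Is It r i + f ≤ k then 1 else s.reg 9) ∧
      ∀ x, x < 9 → s'.reg x = s.reg x := by
  have h1 := par_le_one (Is := Is) (It := It) r
  have hrow : row r = 8 * n := by simp [row, hr]
  rw [hrow] at hf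
  have hv : val Is It r i = i + i + par Is It r := rfl
  unfold test
  refine ends_sub i (by simp [h12, hR.r2]) ?_
  refine ends_add (i + i) (by simp) (by omega) ?_
  refine ends_add (val Is It r i) (by simp [h15, val]) (by omega) ?_
  refine ends_add (8 * n + i) (by simp [hR.r6]) (by omega) ?_
  refine ends_load f (by simp [hf]) ?_
  refine ends_add (val Is It r i + f) (by simp [Nat.add_comm]) (by omega) ?_
  refine ends_lt (if k < val Is It r i + f then 1 else 0) (by simp [hR.r1]) ?_
  refine ends_cons (T := 3) (T' := 1) (ends_ite (fun h => ?_) (fun h => ?_))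
  · simp only [setReg_reg, if_true] at h
    refine (ends_skip ?_).mono (by omega : 1 ≤ 2) fun _ h => h
    refine ends_nil ⟨rfl, by simp, by simp, ?_, fun x hx => ?_⟩
    · have hk : k < val Is It r i + f := by
        by_contra hc
        exact h (if_neg hc)
      simp
      omega
    · simp only [setReg_reg]
      repeat rw [if_neg (by omega)]
  · simp only [setReg_reg, if_true] at h
    refine ends_const 1 (by omega) (ends_nil ?_)
    refine ends_nil ⟨rfl, by simp, by simp, ?_, fun x hx => ?_⟩
    · have hk : ¬ k < val Is It r i + f := by
        intro hc
        rw [if_pos hc] at h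
        omega
      simp
      omega
    · simp only [setReg_reg]
      repeat rw [if_neg (by omega)]

theorem ends_decideRoot (hw : 16 * n + n * (n + 1) + 16 ≤ 2 ^ w) {r : Fin n} (hr : (r : ℕ) = 0)
    {P : Prop} {s : State} (hs : Shrunk Is It k r P 0 s) :
    Ends w decideRoot (5 + (((n + 1) * 12 + 1) + 2)) s fun s' =>
      (s'.reg 0 = 1 ∧ P) ∨ (s'.reg 0 = 0 ∧ ¬ P) := by
  obtain ⟨hR, h9, -, A, M, F, hG, hlen, -, -, hF, hB, hP⟩ := hs
  obtain rfl : M = [] := List.length_eq_zero_iff.1 hlen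
  cases hG
  rw [feasible_nil_iff] at hP
  have hle : ∀ j, F r j ≤ n := by
    intro j
    have := hB j
    rw [sum_singleton] at this
    omega
  have m0 := hR.memIs r
  have m1 := hR.memIt r
  rw [hr] at m0 m1
  rw [Nat.add_zero] at m1
  have hxp : 1 - (if (if r ∈ Is then 1 else 0 : ℕ) = if r ∈ It then 1 else 0
      then 1 else 0) = par Is It r := by
    unfold par
    by_cases a : r ∈ Is <;> by_cases b : r ∈ It <;> simp [a, b]
  unfold decideRoot
  rw [Nat.add_comm]
  refine ends_load (if r ∈ Is then 1 else 0) (by simp [hR.r8, m0]) ?_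
  refine ends_load (if r ∈ It then 1 else 0) (by simp [hR.r0, m1]) ?_
  refine ends_eq _ rfl ?_
  refine ends_sub (par Is It r) (by rw [← hxp]; simp [hR.r2]) ?_
  refine ends_add (n + 1) (by simp [hR.r7, hR.r8]) (by omega) ?_
  classical
  let Inv : ℕ → State → Prop := fun i s' => s'.reg 12 = i ∧ i ≤ n + 1 ∧ s'.mem = s.mem ∧
    (∀ x, x < 9 → s'.reg x = s.reg x) ∧ s'.reg 15 = par Is It r ∧
    s'.reg 9 = if ∃ j, i ≤ j ∧ j ≤ n ∧ val Is It r j + F r j ≤ k then 1 else 0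
  refine ends_cons (T := (n + 1) * 12 + 1) (T' := 2) ((ends_while Inv 11 ?_ (fun s h => h.1)
    (n + 1) _ ⟨?_, le_rfl, ?_, fun x hx => ?_, ?_, ?_⟩).mono le_rfl ?_)
  · rintro i s1 ⟨h1, h2, h3, h4, h5, h6⟩
    refine ⟨by omega, ?_⟩
    have hR1 : Ready Is It k s1 := hR.of_eq (fun r hr => h4 r (by omega)) fun x _ => by rw [h3]
    refine (ends_test hw hr hR1 (i := i) (f := F r i) (by omega) h5 h1
      (by rw [h3]; exact hF r i (by omega)) (hle i)).mono le_rfl ?_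
    rintro s2 ⟨a, b, c, d, e⟩
    refine ⟨b, by omega, by rw [a, h3], fun x hx => by rw [e x hx, h4 x hx], by rw [c, h5], ?_⟩
    rw [d, h6]
    by_cases h : val Is It r i + F r i ≤ k
    · rw [if_pos h, if_pos ⟨i, le_rfl, by omega, h⟩]
    · rw [if_neg h]
      refine if_congr ⟨?_, ?_⟩ rfl rfl
      · rintro ⟨j, j1, j2⟩
        exact ⟨j, by omega, j2⟩
      · rintro ⟨j, j1, j2, j3⟩
        refine ⟨j, ?_, j2, j3⟩
        rcases Nat.lt_or_ge i j with h' | h'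
        · exact h'
        · obtain rfl : j = i := by omega
          exact absurd j3 h
  · simp
  · rfl
  · simp only [setReg_reg]
    repeat rw [if_neg (by omega)]
  · simp
  · simp only [setReg_reg, Nat.reduceEqDiff, if_false, h9]
    refine (if_neg ?_).symm
    rintro ⟨j, j1, j2, -⟩
    omega
  · rintro s1 ⟨-, -, -, h4, -, h6⟩
    refine ends_add (s1.reg 9) (by rw [h4 8 (by omega), hR.r8, Nat.add_zero]) ?_ (ends_nil ?_)
    · rw [h6]; split_ifs <;> omega
    · simp only [setReg_reg, if_true]
      by_cases h : P
      · left
        obtain ⟨j, j1, j2⟩ := hP.2 h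
        rw [h6, if_pos ⟨j, Nat.zero_le j, j1, j2⟩]
        exact ⟨rfl, h⟩
      · right
        rw [h6, if_neg]
        · exact ⟨rfl, h⟩
        · rintro ⟨j, -, j1, j2⟩
          exact h (hP.1 ⟨j, j1, j2⟩)

end

/-! ### Growing the tree on the machine -/

/-- The state while the tree is grown: `A` is the set of visited vertices and `M` the list of
attached pairs. -/
structure Grown {n : ℕ} (G : SimpleGraph (Fin n)) (Is It : Finset (Fin n)) (k : ℕ)
    (es : List (Fin n × Fin n)) (r : Fin n) (A : Finset (Fin n)) (M : List (Fin n × Fin n))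
    (s : State) : Prop where
  ready : Ready Is It k s
  r9 : s.reg 9 = 0
  r10 : s.reg 10 = M.length
  grows : Grows r M A
  adj : ∀ e ∈ M, G.Adj e.1 e.2
  visited : ∀ v : Fin n, s.mem (4 * n + v) = if v ∈ A then 1 else 0
  stored : Stored s.mem (5 * n) M
  edges : ∀ (i : ℕ) (h : i < es.length),
    s.mem (2 * n + 2 * i) = es[i].1 ∧ s.mem (2 * n + 2 * i + 1) = es[i].2
  zero : ∀ x, 8 * n ≤ x → s.mem x = 0

section

variable {n k w : ℕ} {G : SimpleGraph (Fin n)} {Is It A : Finset (Fin n)}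
  {es M : List (Fin n × Fin n)} {r : Fin n}

theorem Grown.of_eq {s s' : State} (h : Grown G Is It k es r A M s) (hm : s'.mem = s.mem)
    (hr : ∀ x, x < 11 → s'.reg x = s.reg x) : Grown G Is It k es r A M s' where
  ready := h.ready.of_eq (fun x hx => hr x (by omega)) fun x _ => by rw [hm]
  r9 := by rw [hr 9 (by omega), h.r9]
  r10 := by rw [hr 10 (by omega), h.r10]
  grows := h.grows
  adj := h.adj
  visited := by rw [hm]; exact h.visited
  stored := by rw [hm]; exact h.stored
  edges := by rw [hm]; exact h.edges
  zero := by rw [hm]; exact h.zero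

theorem ends_attach (hw : 16 * n + n * (n + 1) + 16 ≤ 2 ^ w) (hes : es.length ≤ n) {p c : Fin n}
    {s : State} (h : Grown G Is It k es r A M s) (h13 : s.reg 13 = p) (h14 : s.reg 14 = c)
    (hp : p ∈ A) (hc : c ∉ A) (hpc : G.Adj p c) :
    Ends w attach 9 s fun s' => Grown G Is It k es r (insert c A) ((p, c) :: M) s' ∧
      s'.reg 11 = s.reg 11 ∧ s'.reg 12 = s.reg 12 := by
  have hn := card_add_two_le h.grows hc
  have hp2 := p.2
  have hc2 := c.2
  have hR := h.ready
  unfold attach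
  refine ends_add (M.length + M.length) (by simp [h.r10]) (by omega) ?_
  refine ends_add (5 * n + 2 * M.length) (by simp [hR.r5]; omega) (by omega) ?_
  refine ends_store (5 * n + 2 * M.length) p (by simp) (by simp [h13]) ?_
  refine ends_add (5 * n + 2 * M.length + 1) (by simp [hR.r2]) (by omega) ?_
  refine ends_store (5 * n + 2 * M.length + 1) c (by simp) (by simp [h14]) ?_
  refine ends_add (4 * n + c) (by simp [hR.r4, h14]) (by omega) ?_
  refine ends_store (4 * n + c) 1 (by simp) (by simp [hR.r2]) ?_
  refine ends_add (M.length + 1) (by simp [hR.r2, h.r10]) (by omega) ?_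
  have hmem : ∀ x, x ≠ 5 * n + 2 * M.length → x ≠ 5 * n + 2 * M.length + 1 → x ≠ 4 * n + c →
      ∀ t : State, (setReg (setMem (setReg (setMem (setReg (setMem t (5 * n + 2 * M.length) p) 24
        (5 * n + 2 * M.length + 1)) (5 * n + 2 * M.length + 1) c) 24 (4 * n + c)) (4 * n + c) 1) 10
        (M.length + 1)).mem x = t.mem x := by
    intro x h1 h2 h3 t
    simp only [setReg_mem, setMem_mem]
    rw [if_neg h3, if_neg h2, if_neg h1]
  refine ends_nil ⟨⟨?_, by simp [h.r9], by simp, h.grows.cons hp hc, fun e he => ?_, fun v => ?_,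
    ⟨?_, ?_, ?_⟩, fun i hi => ⟨?_, ?_⟩, fun x hx => ?_⟩, by simp, by simp⟩
  · refine hR.of_eq (fun x hx => ?_) fun x hx => ?_
    · simp only [setReg_reg, setMem_reg]
      repeat rw [if_neg (by omega)]
    · rw [hmem x (by omega) (by omega) (by omega)]
      rfl
  · rcases List.mem_cons.1 he with rfl | he
    · exact hpc
    · exact h.adj e he
  · have hv2 := v.2
    by_cases hv : v = c
    · simp [hv]
    · have hv' : (v : ℕ) ≠ c := fun h => hv (Fin.ext h)
      rw [hmem _ (by omega) (by omega) (by omega)]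
      simp [h.visited, hv]
  · simp only [setReg_mem, setMem_mem]
    rw [if_neg (by omega), if_neg (by omega), if_pos trivial]
  · simp only [setReg_mem, setMem_mem]
    rw [if_neg (by omega), if_pos trivial]
  · refine h.stored.of_eq fun y h1 h2 => ?_
    rw [hmem _ (by omega) (by omega) (by omega)]
    rfl
  · rw [hmem _ (by omega) (by omega) (by omega)]
    exact (h.edges i hi).1
  · rw [hmem _ (by omega) (by omega) (by omega)]
    exact (h.edges i hi).2
  · rw [hmem _ (by omega) (by omega) (by omega)]
    exact h.zero x hx

theorem ends_swap {s : State} {a b : ℕ} (h8 : s.reg 8 = 0) (h13 : s.reg 13 = a)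
    (h14 : s.reg 14 = b) (ha : a < 2 ^ w) (hb : b < 2 ^ w) :
    Ends w swap 4 s fun s' => s'.mem = s.mem ∧ s'.reg 13 = b ∧ s'.reg 14 = a ∧
      ∀ x, x < 13 → s'.reg x = s.reg x := by
  unfold swap
  refine ends_add a (by simp [h13, h8]) ha ?_
  refine ends_add b (by simp [h14, h8]) hb ?_
  refine ends_add a (by simp [h8]) ha ?_
  refine ends_nil ⟨rfl, by simp, by simp, fun x hx => ?_⟩
  simp only [setReg_reg]
  repeat rw [if_neg (by omega)]

/-- Scanning an edge attaches one of its ends, unless both or none of them have been visited. -/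
theorem ends_scan (hw : 16 * n + n * (n + 1) + 16 ≤ 2 ^ w) (hes : es.length ≤ n)
    (hadj : ∀ e ∈ es, G.Adj e.1 e.2) {s : State} (h : Grown G Is It k es r A M s) {i : ℕ}
    (hi : i < es.length) (h12 : s.reg 12 = i + 1) :
    Ends w scan 28 s fun s' => s'.reg 11 = s.reg 11 ∧ s'.reg 12 = i ∧ ∃ A' M',
      Grown G Is It k es r A' M' s' ∧ A ⊆ A' ∧ (A' = A → (es[i].1 ∈ A ↔ es[i].2 ∈ A)) := by
  obtain ⟨e1, e2⟩ := h.edges i hi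
  have hE := hadj _ (List.getElem_mem hi)
  generalize es[i].1 = u at *
  generalize es[i].2 = v at *
  have hR := h.ready
  have hu := u.2
  have hv := v.2
  unfold scan
  refine ends_sub i (by simp [h12, hR.r2]) ?_
  refine ends_add (i + i) (by simp) (by omega) ?_
  refine ends_add (2 * n + 2 * i) (by simp [hR.r3]; omega) (by omega) ?_
  refine ends_load u (by simp [e1]) ?_
  refine ends_add (2 * n + 2 * i + 1) (by simp [hR.r2]) (by omega) ?_
  refine ends_load v (by simp [e2]) ?_
  refine ends_add (4 * n + u) (by simp [hR.r4]) (by omega) ?_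
  refine ends_load (if u ∈ A then 1 else 0) (by simp [h.visited]) ?_
  refine ends_add (4 * n + v) (by simp [hR.r4]) (by omega) ?_
  refine ends_load (if v ∈ A then 1 else 0) (by simp [h.visited]) ?_
  refine ends_eq (if u ∈ A ↔ v ∈ A then 1 else 0)
    (by by_cases a : u ∈ A <;> by_cases b : v ∈ A <;> simp [a, b]) ?_
  have key : ∀ t : State, t.mem = s.mem → (∀ x, x < 11 → t.reg x = s.reg x) →
      t.reg 11 = s.reg 11 → t.reg 12 = i → t.reg 13 = u → t.reg 14 = v →
      t.reg 25 = (if u ∈ A then 1 else 0) → t.reg 27 = (if u ∈ A ↔ v ∈ A then 1 else 0) →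
      Ends w (block [.ite 27 .skip (block [.ite 25 .skip swap, attach])]) 17 t fun s' =>
        s'.reg 11 = s.reg 11 ∧ s'.reg 12 = i ∧ ∃ A' M',
        Grown G Is It k es r A' M' s' ∧ A ⊆ A' ∧ (A' = A → (u ∈ A ↔ v ∈ A)) := by
    intro t tm tr t11 t12 t13 t14 t25 t27
    have ht := h.of_eq tm tr
    refine ends_cons (T := 16) (T' := 1) (ends_ite (fun h27 => ?_) (fun h27 => ?_))
    · have huv : u ∈ A ↔ v ∈ A := by
        by_contra hc
        rw [t27, if_neg hc] at h27
        exact h27 rfl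
      exact (ends_skip (ends_nil ⟨t11, t12, A, M, ht, Subset.rfl, fun _ => huv⟩)).mono
        (by omega : 1 ≤ 15) fun _ h => h
    · have huv : ¬ (u ∈ A ↔ v ∈ A) := by
        intro hc
        rw [t27, if_pos hc] at h27
        omega
      refine ends_cons (T := 5) (T' := 10) (ends_ite (fun h25 => ?_) (fun h25 => ?_))
      · have huA : u ∈ A := by
          by_contra hc
          rw [t25, if_neg hc] at h25
          exact h25 rfl
        have hvA : v ∉ A := by tauto
        refine (ends_skip ?_).mono (by omega : 1 ≤ 4) fun _ h => h
        refine ends_cons (T := 9) (T' := 1)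
          ((ends_attach hw hes ht t13 t14 huA hvA hE).mono le_rfl ?_)
        rintro s' ⟨g, g11, g12⟩
        refine ends_nil (ends_nil ⟨g11.trans t11, g12.trans t12, _, _, g, subset_insert _ _,
          fun hc => ?_⟩)
        exact absurd (insert_eq_self.1 hc) hvA
      · have huA : u ∉ A := by
          intro hc
          rw [t25, if_pos hc] at h25
          omega
        have hvA : v ∈ A := by tauto
        refine (ends_swap (by rw [tr 8 (by omega), hR.r8]) t13 t14 (by omega) (by omega)).mono
          le_rfl ?_
        rintro t' ⟨m', t13', t14', f'⟩
        refine ends_cons (T := 9) (T' := 1) ((ends_attach hw hes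
          (ht.of_eq m' fun x hx => f' x (by omega)) t13' t14' hvA huA hE.symm).mono le_rfl ?_)
        rintro s' ⟨g, g11, g12⟩
        refine ends_nil (ends_nil ⟨?_, ?_, _, _, g, subset_insert _ _, fun hc => ?_⟩)
        · rw [g11, f' 11 (by omega), t11]
        · rw [g12, f' 12 (by omega), t12]
        · exact absurd (insert_eq_self.1 hc) huA
  refine key _ rfl (fun x hx => ?_) (by simp) (by simp) (by simp) (by simp) (by simp) (by simp)
  simp only [setReg_reg]
  repeat rw [if_neg (by omega)]

/-- After `n` rounds all vertices have been visited, because every round before that visits a new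
vertex. -/
theorem ends_grow (hw : 16 * n + n * (n + 1) + 16 ≤ 2 ^ w) (hG : G.Connected)
    (hes : es.length + 1 = n) (hadj : ∀ u v, G.Adj u v ↔ (u, v) ∈ es ∨ (v, u) ∈ es) {s : State}
    (h : Grown G Is It k es r {r} [] s) (h11 : s.reg 11 = n) :
    Ends w grow (n * ((((n * 29 + 1) + 1) + 1 + 1) + 1) + 1) s fun s' =>
      ∃ M, Grown G Is It k es r univ M s' := by
  have hadj' : ∀ e ∈ es, G.Adj e.1 e.2 := fun e he => (hadj _ _).2 (Or.inl he)
  let Inv : ℕ → State → Prop := fun m s => s.reg 11 = m ∧ ∃ A M, Grown G Is It k es r A M s ∧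
    (A = univ ∨ n + 1 ≤ A.card + m)
  refine (ends_while Inv _ ?_ (fun s h => h.1) n s
    ⟨h11, {r}, [], h, Or.inr (by simp [Nat.add_comm])⟩).mono le_rfl ?_
  · rintro m s ⟨h11, A, M, hA, hcard⟩
    refine ⟨by omega, ?_⟩
    refine ends_sub m (by simp [h11, hA.ready.r2]) ?_
    refine ends_sub es.length (by simp [hA.ready.r0, hA.ready.r2]; omega) ?_
    -- while no new vertex has been visited in this round, the edges seen do not leave `A`
    let Inv' : ℕ → State → Prop := fun i s => s.reg 12 = i ∧ i ≤ es.length ∧ s.reg 11 = m ∧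
      ∃ A' M', Grown G Is It k es r A' M' s ∧ A ⊆ A' ∧
        (A' = A → ∀ j (hj : j < es.length), i ≤ j → (es[j].1 ∈ A ↔ es[j].2 ∈ A))
    refine ends_cons (T := n * 29 + 1) (T' := 1) ((ends_while Inv' 28 ?_ (fun s h => h.1)
      es.length _ ⟨?_, le_rfl, ?_, A, M, hA.of_eq ?_ ?_, Subset.rfl, ?_⟩).mono ?_ ?_)
    · rintro i s ⟨h12, hi, h11, A', M', hA', hsub, hclosed⟩
      refine ⟨by omega, (ends_scan hw (by omega) hadj' hA' (i := i) (by omega) h12).mono le_rfl ?_⟩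
      rintro s' ⟨g11, g12, A'', M'', hA'', hsub', hstep⟩
      refine ⟨g12, by omega, g11.trans h11, A'', M'', hA'', hsub.trans hsub', ?_⟩
      rintro rfl j hj hij
      obtain rfl : A' = A'' := Subset.antisymm hsub' hsub
      rcases Nat.lt_or_ge i j with h' | h'
      · exact hclosed rfl j hj h'
      · obtain rfl : j = i := by omega
        exact hstep rfl
    · simp
    · simp
    · rfl
    · intro x hx
      simp only [setReg_reg]
      repeat rw [if_neg (by omega)]
    · intro _ j hj hij
      omega
    · have := Nat.mul_le_mul_right 29 (by omega : es.length ≤ n)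
      omega
    · rintro s' ⟨-, -, g11, A', M', hA', hsub, hclosed⟩
      refine ends_nil ⟨g11, A', M', hA', ?_⟩
      rcases hcard with rfl | hcard
      · exact Or.inl (univ_subset_iff.1 hsub)
      · by_cases heq : A' = A
        · left
          refine eq_univ_of_closed hG hA'.grows.root_mem fun u v huv hu => ?_
          rw [heq] at hu ⊢
          rcases (hadj u v).1 huv with he | he
          · obtain ⟨j, hj, hje⟩ := List.getElem_of_mem he
            have := hclosed heq j hj (Nat.zero_le j)
            rw [hje] at this
            exact this.1 hu
          · obtain ⟨j, hj, hje⟩ := List.getElem_of_mem he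
            have := hclosed heq j hj (Nat.zero_le j)
            rw [hje] at this
            exact this.2 hu
        · right
          have := card_lt_card (ssubset_of_subset_of_ne hsub (Ne.symm heq))
          omega
  · rintro s' ⟨-, A', M', hA', hc⟩
    rcases hc with rfl | hc
    · exact ⟨M', hA'⟩
    · have := card_le_univ A'
      rw [Fintype.card_fin] at this
      omega

/-! ### The initial state -/

theorem getD_flatMap_edges (es : List (Fin n × Fin n)) (i : ℕ) (h : i < es.length) :
    (es.flatMap fun e : Fin n × Fin n => [(e.1 : ℕ), (e.2 : ℕ)]).getD (2 * i) 0 = es[i].1 ∧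
    (es.flatMap fun e : Fin n × Fin n => [(e.1 : ℕ), (e.2 : ℕ)]).getD (2 * i + 1) 0 = es[i].2 := by
  induction es generalizing i with
  | nil => simp at h
  | cons e es ih =>
    cases i with
    | zero => simp
    | succ i =>
      have := ih i (by simpa using h)
      simpa [Nat.mul_add] using this

theorem length_flatMap_edges (es : List (Fin n × Fin n)) :
    (es.flatMap fun e : Fin n × Fin n => [(e.1 : ℕ), (e.2 : ℕ)]).length = 2 * es.length := by
  induction es with
  | nil => simp
  | cons e es ih =>
    rw [List.flatMap_cons, List.length_append, ih]
    simp only [List.length_cons, List.length_nil]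
    omega

theorem input_mem_Is (v : Fin n) : (input Is It k es).mem v = if v ∈ Is then 1 else 0 := by
  unfold input
  simp only
  rw [List.getD_append _ _ _ _ (by simp; omega), List.getD_append _ _ _ _ (by simp)]
  simp

theorem input_mem_It (v : Fin n) : (input Is It k es).mem (n + v) = if v ∈ It then 1 else 0 := by
  unfold input
  simp only
  rw [List.getD_append _ _ _ _ (by simp), List.getD_append_right _ _ _ _ (by simp)]
  simp

theorem input_mem_edge (x : ℕ) : (input Is It k es).mem (2 * n + x) =
    (es.flatMap fun e : Fin n × Fin n => [(e.1 : ℕ), (e.2 : ℕ)]).getD x 0 := by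
  unfold input
  simp only
  rw [List.getD_append_right _ _ _ _ (by simp; omega)]
  congr 1
  simp
  omega

theorem input_mem_zero {x : ℕ} (hx : 2 * n + 2 * es.length ≤ x) :
    (input Is It k es).mem x = 0 := by
  obtain ⟨y, rfl⟩ := Nat.exists_eq_add_of_le (by omega : 2 * n ≤ x)
  rw [input_mem_edge, List.getD_eq_default]
  rw [length_flatMap_edges]
  omega

theorem ends_setup (hw : 16 * n + n * (n + 1) + 16 ≤ 2 ^ w) (hr : (r : ℕ) = 0)
    (hes : es.length + 1 = n) :
    Ends w setup 9 (input Is It k es) fun s => Grown G Is It k es r {r} [] s ∧ s.reg 11 = n := by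
  have h0 : (input Is It k es).reg 0 = n := by simp [input]
  have h1 : (input Is It k es).reg 1 = k := by simp [input]
  have h2 : ∀ x, 2 ≤ x → (input Is It k es).reg x = 0 := by
    intro x hx
    simp only [input]
    rw [if_neg (by omega), if_neg (by omega)]
  have m1 := input_mem_Is (Is := Is) (It := It) (k := k) (es := es)
  have m2 := input_mem_It (Is := Is) (It := It) (k := k) (es := es)
  have m3 := input_mem_edge (Is := Is) (It := It) (k := k) (es := es)
  have m4 := fun x => input_mem_zero (Is := Is) (It := It) (k := k) (es := es) (x := x)
  generalize input Is It k es = s at *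
  unfold setup
  refine ends_const 1 (by omega) ?_
  refine ends_add (2 * n) (by simp [h0]; omega) (by omega) ?_
  refine ends_add (4 * n) (by simp; omega) (by omega) ?_
  refine ends_add (5 * n) (by simp [h0]; omega) (by omega) ?_
  refine ends_add (8 * n) (by simp; omega) (by omega) ?_
  refine ends_add (n + 1) (by simp [h0]) (by omega) ?_
  refine ends_store (4 * n) 1 (by simp) (by simp) ?_
  refine ends_add n (by simp [h0, h2]) (by omega) ?_
  refine ends_nil ⟨⟨⟨?_, ?_, ?_, ?_, ?_, ?_, ?_, ?_, ?_, fun v => ?_, fun v => ?_⟩, ?_, ?_, .nil,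
    by simp, fun v => ?_, trivial, fun i hi => ⟨?_, ?_⟩, fun x hx => ?_⟩, by simp⟩
  · simp [h0]
  · simp [h1]
  · simp
  · simp
  · simp
  · simp
  · simp
  · simp
  · simp [h2]
  · have := v.2
    simp only [setReg_mem, setMem_mem]
    rw [if_neg (by omega), m1]
  · have := v.2
    simp only [setReg_mem, setMem_mem]
    rw [if_neg (by omega), m2]
  · simp [h2]
  · simp [h2]
  · have := v.2
    simp only [setReg_mem, setMem_mem, mem_singleton]
    by_cases hv : v = r
    · rw [if_pos (by rw [hv, hr]; rfl), if_pos hv]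
    · have hv' : (v : ℕ) ≠ r := fun h => hv (Fin.ext h)
      rw [if_neg (by omega), if_neg hv, m4 _ (by omega)]
  · simp only [setReg_mem, setMem_mem]
    rw [if_neg (by omega), m3, (getD_flatMap_edges es i hi).1]
  · simp only [setReg_mem, setMem_mem]
    rw [if_neg (by omega), Nat.add_assoc, m3, (getD_flatMap_edges es i hi).2]
  · simp only [setReg_mem, setMem_mem]
    rw [if_neg (by omega), m4 _ (by omega)]

/-- Once the tree has been grown, the untouched memory serves as tables with all entries `0`. -/
theorem Grown.shrunk {s : State} (h : Grown G Is It k es r univ M s) (hG : G.IsTree)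
    (hIs : G.IsIndepSet (Is : Set (Fin n))) (hIt : G.IsIndepSet (It : Set (Fin n))) :
    Shrunk Is It k r (G.SymISR (Is : Set (Fin n)) (It : Set (Fin n)) k) M.length s := by
  refine ⟨h.ready, h.r9, h.r10, univ, M, fun _ _ => 0, h.grows, rfl,
    fun e he => len_add_par hIs hIt (h.adj e he), h.stored, fun v i _ => ?_, by simp, ?_⟩
  · exact h.zero _ (by unfold row; omega)
  · have := symISR_iff_feasible (K := k) h.grows (h.grows.adj_iff hG h.adj) hIs hIt
    rw [Fintype.card_fin] at this
    exact this.symm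

end

/-- Words of `8 * Nat.size n` bits can hold all addresses that are used. -/
theorem address_bound {n w : ℕ} (h : 8 * Nat.size n ≤ w) (hn : 1 ≤ n) :
    16 * n + n * (n + 1) + 16 ≤ 2 ^ w := by
  have h1 : n < 2 ^ Nat.size n := Nat.lt_size_self n
  have h2 : 2 ^ (8 * Nat.size n) ≤ 2 ^ w := Nat.pow_le_pow_right (by omega) h
  rw [Nat.mul_comm, pow_mul] at h2
  refine le_trans ?_ h2
  generalize 2 ^ Nat.size n = q at h1
  have h3 : (n + 1) ^ 8 ≤ q ^ 8 := Nat.pow_le_pow_left h1 8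
  refine le_trans ?_ h3
  have h4 : 2 ^ 6 * (n + 1) ^ 2 ≤ (n + 1) ^ 8 := by
    rw [show (n + 1) ^ 8 = (n + 1) ^ 6 * (n + 1) ^ 2 by ring]
    exact Nat.mul_le_mul_right _ (Nat.pow_le_pow_left (by omega) 6)
  nlinarith

end SymISRTree

open SymISRTree

theorem mainTheorem11 :
    ∃ (P : WordRAM.Prog) (c C : ℕ),
      ∀ (n : ℕ) (G : SimpleGraph (Fin n)) (Is It : Finset (Fin n)) (k : ℕ)
        (es : List (Fin n × Fin n)) (w : ℕ),
        G.IsTree → G.IsIndepSet (Is : Set (Fin n)) → G.IsIndepSet (It : Set (Fin n)) →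
        G.IsEdgeList es → c * Nat.size n ≤ w → k < 2 ^ w →
        ∃ (t : ℕ) (s : WordRAM.State),
          t ≤ C * n ^ 2 ∧
          WordRAM.Run w P (WordRAM.input Is It k es) t s ∧
          ((s.reg 0 = 1 ∧ G.SymISR (Is : Set (Fin n)) (It : Set (Fin n)) k) ∨
            (s.reg 0 = 0 ∧ ¬ G.SymISR (Is : Set (Fin n)) (It : Set (Fin n)) k)) := by
  refine ⟨solve, 8, 500, fun n G Is It k es w hG hIs hIt hes hw _ => ?_⟩
  obtain ⟨r0⟩ := hG.connected.nonempty
  have hn : 1 ≤ n := by have := r0.2; omega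
  have hlen := length_of_isEdgeList hG hes
  rw [Fintype.card_fin] at hlen
  have hB := address_bound hw hn
  suffices h : Ends w solve (500 * n ^ 2) (WordRAM.input Is It k es) fun s =>
      (s.reg 0 = 1 ∧ G.SymISR (Is : Set (Fin n)) (It : Set (Fin n)) k) ∨
        (s.reg 0 = 0 ∧ ¬ G.SymISR (Is : Set (Fin n)) (It : Set (Fin n)) k) from h
  refine Ends.mono (T := 9 + ((n * ((((n * 29 + 1) + 1) + 1 + 1) + 1) + 1) +
    ((n * ((28 + ((n + 1) * 71 + 1 + 1)) + 1) + 1) + ((5 + (((n + 1) * 12 + 1) + 2)) + 1)))) ?_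
    (by nlinarith) fun _ h => h
  refine ends_cons ((ends_setup (G := G) (r := ⟨0, hn⟩) hB rfl hlen).mono le_rfl ?_)
  rintro s1 ⟨h1, h11⟩
  refine ends_cons ((ends_grow hB hG.connected hlen hes.1 h1 h11).mono le_rfl ?_)
  rintro s2 ⟨M, h2⟩
  have hM : M.length ≤ n := by
    have := h2.grows.card_eq
    rw [Finset.card_univ, Fintype.card_fin] at this
    omega
  refine ends_cons ((ends_shrink hB (h2.shrunk hG hIs hIt)).mono ?_ ?_)
  · exact Nat.add_le_add_right (Nat.mul_le_mul_right _ hM) 1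
  · intro s3 h3
    exact ends_cons ((ends_decideRoot hB rfl h3).mono le_rfl fun _ h => ends_nil h)
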